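/- Write $[x,y]$ for the determinant of two vectors of $\mathbb{R}^2$. Let $n\ge 2$ and let $P=\{P_1,\dots,P_{2n}\}$ be a planar convex polygon (indices mod $2n$), its vertices being listed counterclockwise, possibly with consecutive repetitions, with parallel opposite sides in the following sense: for each $i$, either $P_iP_{i+1}$ and $P_{i+n}P_{i+n+1}$ are nondegenerate parallel segments, or exactly one of them degenerates to a point, and the line through this point parallel to the other one meets the convex polygon only at this point. Fix $a>0$ and put $$U_i=\tfrac1{2a}(P_i-P_{i+n}),\qquad V_{i+\frac12}=\frac{U_{i+1}-U_i}{[U_i,U_{i+1}]},$$ the vertices of the unit ball $U$ for which $P$ has constant width and of its dual ball $V$. Let $M(0)$ be the central equidistant of $P$, $M_i(0)=\frac12(P_i+P_{i+n})$, and let $N(0)$ be its evolute, $N_{i+\frac12}(0)=M_i(0)-\alpha_{i+\frac12}(0)U_i$. For $k\ge 0$ define $N(k+1)=\mathrm{Inv}(M(k))$ and $M(k+1)=\mathrm{Inv}(N(k+1))$ by $$N_{i+\frac12}(k+1)=M_i(k)+\Big(\tfrac12\sum_{j=i}^{i+n-1}\alpha_{j+\frac12}(k)\,[U_j,U_{j+1}]\Big)V_{i+\frac12},$$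 $$M_{i}(k+1)=N_{i-\frac12}(k+1)-\Big(\tfrac12\sum_{j=i}^{i+n-1}\beta_j(k+1)\,[V_{j-\frac12},V_{j+\frac12}]\Big)U_i,$$ where $M_{i+1}(k)-M_i(k)=\alpha_{i+\frac12}(k)(U_{i+1}-U_i)$ and $N_{i+\frac12}(k)-N_{i-\frac12}(k)=\beta_i(k)(V_{i+\frac12}-V_{i-\frac12})$. For a closed polygonal arc $A$ let $\overline A$ be the region bounded by $A$, i.e. the complement of the set of points that can be joined to points arbitrarily far away by paths not meeting $A$. Then the set $$O(P)=\bigcap_{k\ge 0}\big(\overline{M(k)}\cap\overline{N(k+1)}\big)$$ consists of a single point $O$, and for all $c,d\in\mathbb{R}$ the following holds. The equidistants $P(k,c)$ with vertices $M_i(k)+cU_i$ have constant $U$-width $2c$, and the equidistants $Q(k,d)$ with vertices $N_{i+\frac12}(k)+dV_{i+\frac12}$ have constant $V$-width $2d$. As $k\to\infty$, in the space $(\mathbb{R}^2)^{2n}$ of $2n$-gons, $P(k,c)$ converges to $O+c\,\partial U$, the polygon with vertices $O+cU_i$, and $Q(k,d)$ converges to $O+d\,\partial V$, the polygon with vertices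 $O+dV_{i+\frac12}$. Here a polygon $A=\{A_i\}$, possibly with cusps, has constant $W$-width $w$ (for $W=U$ or $W=V$) if its sides are multiples of the corresponding sides of $W$, its diagonals satisfy $A_i-A_{i+n}=wW_i$ (indices shifted by $\frac12$ for $V$), and, whenever all its sides are nonnegative multiples of the corresponding sides of $W$ (so that $A$ is convex), $h_A(v)+h_A(-v)=w$ for every $v$ with $h_W(v)=1$, where $h_A(v)=\max_i[A_i,v]$. -/

import Mathlib

open Filter Topology

noncomputable section

/-- The plane `ℝ²`. -/
abbrev Plane : Type := EuclideanSpace ℝ (Fin 2)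

/-- The determinant `[x, y]` of a pair of planar vectors. -/
def det2 (x y : Plane) : ℝ := x 0 * y 1 - x 1 * y 0

/-- The space of `2n`-gons: a polygon is represented by the cyclic list of its `2n` vertices, and
the space carries the product topology of `(ℝ²)^(2n)`. -/
abbrev TwoNGon (n : ℕ) : Type := ZMod (2 * n) → Plane

namespace TwoNGon

variable {n : ℕ}

/-- The side vector `P_{i+1} - P_i`. -/
def side (P : TwoNGon n) (i : ZMod (2 * n)) : Plane := P (i + 1) - P i

/-- `P = (P_1, …, P_{2n})` lists, counterclockwise, the vertices of a convex polygon, possibly with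
consecutive repetitions, in such a way that opposite sides `P_i P_{i+1}`, `P_{i+n} P_{i+n+1}` are
parallel in the broad sense: either both are honest parallel segments, or exactly one of them
degenerates to a point and the line through that point parallel to the other one meets the
polygon only at that point. -/
structure IsConvexWithParallelSides (P : TwoNGon n) : Prop where
  two_le : 2 ≤ n
  /-- every vertex not on a nondegenerate side lies strictly to the left of that side -/
  convex : ∀ i, P.side i ≠ 0 → ∀ j, P j ≠ P i → P j ≠ P (i + 1) →
    0 < det2 (P.side i) (P j - P i)
  /-- the polygon is traversed once: from each vertex only one nondegenerate side starts -/
  once : ∀ i j, P.side i ≠ 0 → P.side j ≠ 0 → P i = P j → i = j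
  parallel : ∀ i, det2 (P.side i) (P.side (i + n)) = 0
  not_both_degenerate : ∀ i, P.side i ≠ 0 ∨ P.side (i + n) ≠ 0
  /-- all vertices other than `P_{i+n} = P_{i+n+1}` lie strictly on one side (the side of
  `P_i P_{i+1}`) of the line through this point parallel to `P_i P_{i+1}` -/
  outside : ∀ i, P.side (i + n) = 0 → ∀ j, P j ≠ P (i + n) →
    det2 (P.side i) (P j - P (i + n)) < 0

/-- The unit ball `U_i = (P_i - P_{i+n}) / (2a)`. -/
def ball (a : ℝ) (P : TwoNGon n) : TwoNGon n := fun i => (1 / (2 * a)) • (P i - P (i + n))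

/-- The dual ball of `W`; the entry with index `i` is
`V_{i+1/2} = (W_{i+1} - W_i) / [W_i, W_{i+1}]`. -/
def dual (W : TwoNGon n) : TwoNGon n :=
  fun i => (det2 (W i) (W (i + 1)))⁻¹ • (W (i + 1) - W i)

/-- The central equidistant `M_i = (P_i + P_{i+n}) / 2`. -/
def centralEquidistant (P : TwoNGon n) : TwoNGon n := fun i => (1 / 2 : ℝ) • (P i + P (i + n))

/-- For a polygon `A` with sides parallel to those of `W`, the number `α_{i+1/2}` with
`A_{i+1} - A_i = α_{i+1/2} (W_{i+1} - W_i)` (see `ratio_eq`). -/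
def ratio (W A : TwoNGon n) (i : ZMod (2 * n)) : ℝ :=
  det2 (W i) (A (i + 1) - A i) / det2 (W i) (W (i + 1))

theorem ratio_eq (W A : TwoNGon n) (i : ZMod (2 * n)) (t : ℝ) (hW : det2 (W i) (W (i + 1)) ≠ 0)
    (h : A (i + 1) - A i = t • (W (i + 1) - W i)) : ratio W A i = t := by
  unfold ratio
  rw [h, div_eq_iff hW]
  simp only [det2, PiLp.smul_apply, PiLp.sub_apply, smul_eq_mul]
  ring

/-- `β_i = (1/2) ∑_{j=i}^{i+n-1} α_{j+1/2} [W_j, W_{j+1}]`. -/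
def beta (W A : TwoNGon n) (i : ZMod (2 * n)) : ℝ :=
  (1 / 2) * ∑ l ∈ Finset.range n, ratio W A (i + l) * det2 (W (i + l)) (W (i + l + 1))

/-- The central involute of a polygon `A` of constant `W`-width with `A_i = A_{i+n}`: the entry with
index `i` is the vertex `A_i + β_i W'_{i+1/2}` with index `i + 1/2`, where `W'` is the dual
of `W`. -/
def involute (W A : TwoNGon n) : TwoNGon n := fun i => A i + beta W A i • dual W i

/-- The evolute of a polygon `A` with sides parallel to those of `W`: the entry with index `i` is
the vertex `A_i - α_{i+1/2} W_i` with index `i + 1/2`. -/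
def evolute (W A : TwoNGon n) : TwoNGon n := fun i => A i - ratio W A i • W i

/-- The pairs `(M(k), N(k))` of iterated involutes: `M(0)` is the central equidistant of `P`,
`N(0)` its evolute, `N(k+1) = Inv(M(k))` and `M(k+1) = Inv(N(k+1))`. The vertex
`N_{i+1/2}(k)` is stored at index `i`; since `Inv` raises the index by `1/2`, the polygon
`involute V N` stores at index `i - 1` the vertex whose index is `(i - 1) + 1/2 + 1/2 = i`. -/
def iterates (a : ℝ) (P : TwoNGon n) : ℕ → TwoNGon n × TwoNGon n
  | 0 => (centralEquidistant P, evolute (ball a P) (centralEquidistant P))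
  | k + 1 =>
    let N := involute (ball a P) (iterates a P k).1
    (fun i => involute (dual (ball a P)) N (i - 1), N)

/-- The polygon `M(k)`. -/
def iterM (a : ℝ) (P : TwoNGon n) (k : ℕ) : TwoNGon n := (iterates a P k).1

/-- The polygon `N(k)`; the vertex `N_{i+1/2}(k)` is stored at index `i`. -/
def iterN (a : ℝ) (P : TwoNGon n) (k : ℕ) : TwoNGon n := (iterates a P k).2

/-- The equidistant `A + cW`, with vertices `A_i + c W_i`. -/
def equidistant (W A : TwoNGon n) (c : ℝ) : TwoNGon n := fun i => A i + c • W i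

/-- The closed polygonal arc formed by the sides. -/
def arc (A : TwoNGon n) : Set Plane := ⋃ i, segment ℝ (A i) (A (i + 1))

/-- The closed region bounded by `A`: the points which cannot be joined, by paths that avoid the
polygonal arc, to points arbitrarily far away. -/
def region (A : TwoNGon n) : Set Plane :=
  {x | ¬ ∀ R : ℝ, ∃ y : Plane, R < ‖y‖ ∧ JoinedIn (arc A)ᶜ x y}

/-- The set `O(P)`: the intersection of the regions bounded by
`M(0), N(1), M(1), N(2), …`. -/
def centralSet (a : ℝ) (P : TwoNGon n) : Set Plane :=
  ⋂ k : ℕ, region (iterM a P k) ∩ region (iterN a P (k + 1))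

/-- The support function of (the convex hull of) `A`, at the functional `[·, v]`. -/
def supportFn (A : TwoNGon n) (v : Plane) : ℝ := ⨆ i, det2 (A i) v

/-- The sides of `A` are nonnegative multiples of the corresponding sides of `W`, so that
(`W` being convex) `A` is a convex polygon, without cusps. -/
def HasNonnegSides (W A : TwoNGon n) : Prop :=
  ∀ i, ∃ t : ℝ, 0 ≤ t ∧ A (i + 1) - A i = t • (W (i + 1) - W i)

/-- `A`, possibly with cusps, is a polygon of constant width `w` with respect to the unit
ball `W`: its sides and diagonals are parallel to those of `W`, the diagonals with a constant
ratio, and, if `A` is convex, its width is `w` at every functional `[·, v]` of dual norm one. -/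
structure HasConstantWidth (W A : TwoNGon n) (w : ℝ) : Prop where
  sides : ∀ i, ∃ t : ℝ, A (i + 1) - A i = t • (W (i + 1) - W i)
  diagonals : ∀ i, A i - A (i + n) = w • W i
  width : HasNonnegSides W A →
    ∀ v : Plane, supportFn W v = 1 → supportFn A v + supportFn A (-v) = w

end TwoNGon

end

/-!
The unit ball `U` is a centrally symmetric strictly convex polygon (`IsBall`), and so is its dual
`V`; taking the dual twice gives `-U` with the index raised by one, so one step
`A ↦ involute W A` covers both `M(k) ↦ N(k+1)` and `N(k+1) ↦ M(k+1)`. The polygons `M(k)` and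
`N(k)` have width zero (`IsCentral`), and their equidistants inherit sides and diagonals from `U`
and `V`. A convex polygon with the directions of the sides of `W` attains its support function at the
same vertices as `W`, which turns the condition on diagonals into the condition on widths
(`IsBall.width_eq`).

Two facts give the convergence.

*Nesting* (`IsBall.arc_involute_subset`): the involute of `A` lies in the region bounded by `A`. For
a point `x` consider the cyclic sequence `[x - A_i, S_i]`, where `S_i` are the sides of `W`. Off
`A`, a term can vanish only between two terms of opposite signs, so the number of sign changes is
locally constant in `x`; a distant point sees one change per half turn. For `x` on the involute, the
sum of the terms over a suitable half turn is zero while its two ends have the same sign, and this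
produces three changes per half turn.

*Contraction* (`IsBall.energy_involute`): the ratios `α` of the sides of `A` and `β` of its involute
satisfy `β_{i+1} - β_i = -w_i α_i` with `w_i = [W_i, W_{i+1}]`, so a discrete Wirtinger inequality
(`IsBall.wirtinger`), proved with Picone's identity, bounds the weighted square sum of `β` by that
of `α`. Equality forces `α_i = -[V_i, u]`, which the closing condition on the sides of `A` excludes
unless `α = 0`.

By nesting the `M(k)` stay bounded. The energy of a limit point is not lowered by a double involute,
so the limit point has all its vertices at one point `O`; some region, and by nesting every later
one, is then contained in an arbitrarily small disc around `O`.
-/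

/-! ### The determinant of planar vectors -/

theorem det2_add_left (x y z : Plane) : det2 (x + y) z = det2 x z + det2 y z := by
  simp only [det2, PiLp.add_apply]; ring

theorem det2_add_right (x y z : Plane) : det2 x (y + z) = det2 x y + det2 x z := by
  simp only [det2, PiLp.add_apply]; ring

theorem det2_sub_left (x y z : Plane) : det2 (x - y) z = det2 x z - det2 y z := by
  simp only [det2, PiLp.sub_apply]; ring

theorem det2_sub_right (x y z : Plane) : det2 x (y - z) = det2 x y - det2 x z := by
  simp only [det2, PiLp.sub_apply]; ring

theorem det2_neg_left (x y : Plane) : det2 (-x) y = -det2 x y := by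
  simp only [det2, PiLp.neg_apply]; ring

theorem det2_neg_right (x y : Plane) : det2 x (-y) = -det2 x y := by
  simp only [det2, PiLp.neg_apply]; ring

theorem det2_smul_left (t : ℝ) (x y : Plane) : det2 (t • x) y = t * det2 x y := by
  simp only [det2, PiLp.smul_apply, smul_eq_mul]; ring

theorem det2_smul_right (t : ℝ) (x y : Plane) : det2 x (t • y) = t * det2 x y := by
  simp only [det2, PiLp.smul_apply, smul_eq_mul]; ring

theorem det2_self (x : Plane) : det2 x x = 0 := by
  simp only [det2]; ring

theorem det2_swap (x y : Plane) : det2 x y = -det2 y x := by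
  simp only [det2]; ring

theorem det2_zero_left (x : Plane) : det2 0 x = 0 := by simp [det2]

theorem det2_zero_right (x : Plane) : det2 x 0 = 0 := by simp [det2]

/-- Cramer's rule in the plane. -/
theorem det2_cramer (x y z : Plane) : det2 x y • z = det2 z y • x + det2 x z • y := by
  ext i
  fin_cases i <;> simp [det2] <;> ring

theorem exists_smul_of_det2_eq_zero {x y : Plane} (hx : x ≠ 0) (h : det2 x y = 0) :
    ∃ t : ℝ, y = t • x := by
  have h01 : x 0 ≠ 0 ∨ x 1 ≠ 0 := by
    by_contra! hc
    apply hx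
    ext i
    fin_cases i <;> simp [hc.1, hc.2]
  simp only [det2] at h
  rcases h01 with h0 | h1
  · refine ⟨y 0 / x 0, ?_⟩
    ext i
    fin_cases i
    · simp [h0]
    · simp; field_simp; linarith
  · refine ⟨y 1 / x 1, ?_⟩
    ext i
    fin_cases i
    · simp; field_simp; linarith
    · simp [h1]

theorem continuous_det2 : Continuous fun p : Plane × Plane => det2 p.1 p.2 := by
  unfold det2
  fun_prop

namespace TwoNGon

variable {n : ℕ}

/-! ### Cyclic indices -/

theorem natCast_inj_of_lt {k l : ℕ} (hk : k < 2 * n) (hl : l < 2 * n)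
    (h : (k : ZMod (2 * n)) = l) : k = l := by
  have := (ZMod.natCast_eq_natCast_iff' k l (2 * n)).1 h
  rwa [Nat.mod_eq_of_lt hk, Nat.mod_eq_of_lt hl] at this

theorem natCast_add_self : (n : ZMod (2 * n)) + n = 0 := by
  have : ((2 * n : ℕ) : ZMod (2 * n)) = 0 := ZMod.natCast_self _
  rw [← this]; push_cast; ring

theorem add_half_add_half (i : ZMod (2 * n)) : i + n + n = i := by
  rw [add_assoc, natCast_add_self, add_zero]

theorem det2_side (W : TwoNGon n) (i : ZMod (2 * n)) :
    det2 (W i) (W.side i) = det2 (W i) (W (i + 1)) := by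
  simp [side, det2_sub_right, det2_self]

theorem dual_eq (W : TwoNGon n) (i : ZMod (2 * n)) :
    dual W i = (det2 (W i) (W (i + 1)))⁻¹ • W.side i := rfl

/-! ### Unit balls and their duals -/

/-- A centrally symmetric, strictly convex `2n`-gon, listed counterclockwise: each vertex lies
strictly to the left of every side of which it is not an end. -/
structure IsBall (W : TwoNGon n) : Prop where
  two_le : 2 ≤ n
  symm : ∀ i, W (i + n) = -W i
  strict : ∀ i j, j ≠ i → j ≠ i + 1 → 0 < det2 (W.side i) (W j - W i)

namespace IsBall

variable {W : TwoNGon n} (h : IsBall W)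
include h

theorem side_half (i : ZMod (2 * n)) : W.side (i + n) = -W.side i := by
  unfold side
  rw [show i + n + 1 = i + 1 + n by ring, h.symm, h.symm]
  abel

theorem nonneg (i j : ZMod (2 * n)) : 0 ≤ det2 (W.side i) (W j - W i) := by
  by_cases h1 : j = i
  · simp [h1, det2_zero_right]
  by_cases h2 : j = i + 1
  · rw [h2]; exact (det2_self _).ge
  exact (h.strict i j h1 h2).le

theorem pos (i : ZMod (2 * n)) : 0 < det2 (W i) (W (i + 1)) := by
  have hn := h.two_le
  have h1 : i + (n : ZMod (2 * n)) ≠ i := by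
    intro hc
    have : (n : ZMod (2 * n)) = (0 : ℕ) := by simpa using hc
    have := natCast_inj_of_lt (by omega) (by omega) this
    omega
  have h2 : i + (n : ZMod (2 * n)) ≠ i + 1 := by
    intro hc
    have : (n : ZMod (2 * n)) = (1 : ℕ) := by simpa using hc
    have := natCast_inj_of_lt (by omega) (by omega) this
    omega
  have := h.strict i (i + n) h1 h2
  rw [h.symm] at this
  simp only [side, det2_sub_left, det2_sub_right, det2_neg_right, det2_self] at this
  rw [det2_swap (W (i + 1)) (W i)] at this
  linarith

theorem side_pos (i : ZMod (2 * n)) : 0 < det2 (W.side i) (W.side (i + 1)) := by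
  have hn := h.two_le
  have h1 : i + 1 + 1 ≠ i := by
    intro hc
    have : ((2 : ℕ) : ZMod (2 * n)) = (0 : ℕ) := by
      rw [add_assoc] at hc
      have := left_eq_add.1 hc.symm
      push_cast
      rw [← this]; norm_num
    have := natCast_inj_of_lt (by omega) (by omega) this
    omega
  have h2 : i + 1 + 1 ≠ i + 1 := by
    intro hc
    have : ((1 : ℕ) : ZMod (2 * n)) = (0 : ℕ) := by simpa using hc
    have := natCast_inj_of_lt (by omega) (by omega) this
    omega
  have := h.strict i (i + 1 + 1) h1 h2
  rw [show W (i + 1 + 1) - W i = W.side (i + 1) + W.side i by simp [side], det2_add_right,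
    det2_self] at this
  linarith

/-- The vertices turn by less than a half turn from `W i` to `W (i + n) = -W i`. At the first
failure the opposite vertex `-W i` would lie in a triangle spanned by the origin and a side, away
from that side, hence would not be extreme. -/
theorem det_pos (i : ZMod (2 * n)) {k : ℕ} (hk : 0 < k) (hkn : k < n) :
    0 < det2 (W i) (W (i + k)) := by
  induction k, hk using Nat.le_induction with
  | base => simpa using h.pos i
  | succ k hk ih =>
    have ih := ih (by omega)
    by_contra! hc
    have hw := h.pos (i + k)
    have hw' := h.pos (i + n)
    have h1 := h.strict (i + k) (i + n)
      (fun hc => by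
        have := natCast_inj_of_lt (n := n) (by omega) (by omega) (add_left_cancel hc)
        omega)
      (fun hc => by
        rw [add_assoc] at hc
        have : (n : ZMod (2 * n)) = ((k + 1 : ℕ) : ZMod (2 * n)) := by
          push_cast; exact add_left_cancel hc
        have := natCast_inj_of_lt (n := n) (by omega) (by omega) this
        omega)
    have h2 := h.nonneg (i + n) (i + k)
    have h3 := h.nonneg (i + n) (i + k + 1)
    have hd := det2_side W (i + n)
    have hcr := det2_cramer (W (i + k)) (W (i + k + 1)) (W (i + n))
    have e1 : det2 (W (i + n)) (W (i + k + 1)) = - det2 (W i) (W (i + k + 1)) := by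
      rw [h.symm, det2_neg_left]
    have e2 : det2 (W (i + k)) (W (i + n)) = det2 (W i) (W (i + k)) := by
      rw [h.symm, det2_neg_right, ← det2_swap]
    rw [show i + ((k + 1 : ℕ) : ZMod (2 * n)) = i + k + 1 by push_cast; ring] at hc
    have h4 := congrArg (det2 (W.side (i + n))) hcr
    have h5 := congrArg (det2 (W.side (i + k))) hcr
    simp only [det2_smul_right, det2_add_right, e1, e2] at h4 h5
    simp only [det2_sub_right] at h1 h2 h3
    rw [det2_swap] at hd
    have g1 : det2 (W.side (i + k)) (W (i + k)) = - det2 (W (i + k)) (W (i + k + 1)) := by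
      rw [det2_swap, det2_side]
    have g2 : det2 (W.side (i + k)) (W (i + k + 1)) = - det2 (W (i + k)) (W (i + k + 1)) := by
      simp [side, det2_sub_left, det2_self]
    rw [g1, g2] at h5
    rw [g1] at h1
    generalize det2 (W (i + k)) (W (i + k + 1)) = w at *
    generalize det2 (W (i + n)) (W (i + n + 1)) = w' at *
    generalize det2 (W.side (i + n)) (W (i + k)) = a at *
    generalize det2 (W.side (i + n)) (W (i + k + 1)) = b at *
    generalize det2 (W.side (i + n)) (W (i + n)) = c at *
    generalize det2 (W.side (i + k)) (W (i + n)) = d at *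
    generalize det2 (W i) (W (i + k)) = f at *
    generalize det2 (W i) (W (i + k + 1)) = g at *
    -- `f - g < w`: the opposite vertex lies strictly on the inner side
    have hd' : d = g - f := by
      apply mul_left_cancel₀ hw.ne'
      linarith
    have hs : f - g < w := by linarith
    nlinarith [mul_nonneg (neg_nonneg.2 hc) h2, mul_nonneg ih.le h3]

theorem side_eq (i : ZMod (2 * n)) :
    W.side i = det2 (W i) (W (i + 1)) • dual W i := by
  rw [dual_eq, smul_inv_smul₀ (h.pos i).ne']

theorem det_dual_self (i : ZMod (2 * n)) : det2 (W i) (dual W i) = 1 := by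
  rw [dual_eq, det2_smul_right, det2_side, inv_mul_cancel₀ (h.pos i).ne']

theorem det_succ_dual (i : ZMod (2 * n)) : det2 (W (i + 1)) (dual W i) = 1 := by
  have : W (i + 1) = W i + W.side i := by simp [side]
  rw [this, det2_add_left, h.det_dual_self, dual_eq, det2_smul_right, det2_self]
  simp

theorem dual_pos (i : ZMod (2 * n)) : 0 < det2 (dual W i) (dual W (i + 1)) := by
  rw [dual_eq, dual_eq, det2_smul_left, det2_smul_right]
  have := h.side_pos i
  have := h.pos i
  have := h.pos (i + 1)
  positivity

theorem dual_side (i : ZMod (2 * n)) :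
    (dual W).side i = -(det2 (dual W i) (dual W (i + 1)) • W (i + 1)) := by
  rw [det2_cramer, h.det_dual_self, det2_swap (dual W i), h.det_succ_dual]
  simp [side, sub_eq_add_neg]

theorem dual_symm (i : ZMod (2 * n)) : dual W (i + n) = -dual W i := by
  rw [dual_eq, dual_eq, h.side_half, show i + n + 1 = i + 1 + n by ring, h.symm, h.symm,
    det2_neg_left, det2_neg_right, neg_neg, smul_neg]

/-- Polar duality: the dual of a unit ball is a unit ball. -/
theorem isBall_dual : IsBall (dual W) where
  two_le := h.two_le
  symm := h.dual_symm
  strict i j h1 h2 := by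
    have hs := h.strict j (i + 1) (fun hc => h2 hc.symm) (fun hc => h1 (add_right_cancel hc).symm)
    have e : 0 < 1 - det2 (W (i + 1)) (dual W j) := by
      rw [dual_eq, det2_smul_right]
      have hp := h.pos j
      rw [← det2_side] at hp ⊢
      rw [det2_sub_right] at hs
      rw [det2_swap (W j), det2_swap (W (i + 1))] at *
      rw [sub_pos, inv_mul_lt_one₀ hp]
      linarith
    rw [h.dual_side, det2_neg_left, det2_smul_left, det2_sub_right, h.det_succ_dual]
    have := mul_pos (h.dual_pos i) e
    linarith

theorem side_det_pos (i : ZMod (2 * n)) {k : ℕ} (hk : 0 < k) (hkn : k < n) :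
    0 < det2 (W.side i) (W.side (i + k)) := by
  rw [h.side_eq, h.side_eq (i + k), det2_smul_left, det2_smul_right]
  have := h.isBall_dual.det_pos i hk hkn
  have := h.pos i
  have := h.pos (i + k)
  positivity

theorem dual_dual (i : ZMod (2 * n)) : dual (dual W) i = -W (i + 1) := by
  rw [dual_eq, h.dual_side, smul_neg, inv_smul_smul₀ (h.dual_pos i).ne']

end IsBall

/-! ### The unit ball of a polygon with parallel opposite sides -/

namespace IsConvexWithParallelSides

variable {P : TwoNGon n} (hP : P.IsConvexWithParallelSides)
include hP

theorem add_half_ne (i : ZMod (2 * n)) : i + (n : ZMod (2 * n)) ≠ i := by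
  intro hc
  have hn := hP.two_le
  have : (n : ZMod (2 * n)) = (0 : ℕ) := by simpa using hc
  have := natCast_inj_of_lt (by omega) (by omega) this
  omega

theorem det_nonneg {i : ZMod (2 * n)} (hi : P.side i ≠ 0) (j : ZMod (2 * n)) :
    0 ≤ det2 (P.side i) (P j - P i) := by
  by_cases h1 : P j = P i
  · simp [h1, det2_zero_right]
  by_cases h2 : P j = P (i + 1)
  · rw [h2]; exact (det2_self _).ge
  exact (hP.convex i hi j h1 h2).le

/-- Two nondegenerate opposite sides have opposite directions. -/
theorem exists_neg_smul {i : ZMod (2 * n)} (hi : P.side i ≠ 0) (hi' : P.side (i + n) ≠ 0) :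
    ∃ t : ℝ, t < 0 ∧ P.side (i + n) = t • P.side i := by
  obtain ⟨t, ht⟩ := exists_smul_of_det2_eq_zero hi (hP.parallel i)
  refine ⟨t, ?_, ht⟩
  by_contra! hc
  have ht0 : 0 < t := lt_of_le_of_ne hc fun h0 => hi' (by rw [ht, ← h0, zero_smul])
  have h1 := hP.det_nonneg hi (i + n)
  have h2 := hP.det_nonneg hi' i
  rw [ht, det2_smul_left, det2_sub_right] at h2
  rw [det2_sub_right] at h1
  have h2 := nonneg_of_mul_nonneg_right h2 ht0
  -- equal directions force the two sides onto one line, where `once` makes each side run back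
  -- along the other
  have hne : P (i + n) ≠ P i := fun hc => hP.add_half_ne i (hP.once _ _ hi' hi hc)
  have e1 : P (i + n) = P (i + 1) := by
    by_contra hc
    have := hP.convex i hi _ hne hc
    rw [det2_sub_right] at this
    linarith
  have e2 : P i = P (i + n + 1) := by
    by_contra hc
    have := hP.convex (i + n) hi' _ hne.symm hc
    rw [ht, det2_smul_left, det2_sub_right] at this
    have := (mul_pos_iff_of_pos_left ht0).1 this
    linarith
  have e3 : P.side (i + n) = -P.side i := by
    simp [side, ← e1, ← e2]
  have : (t + 1) • P.side i = 0 := by rw [add_smul, ← ht, e3]; simp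
  rcases smul_eq_zero.1 this with h | h
  · linarith
  · exact hi h

/-- The direction of the `i`-th side of the ball supports `P` along its `i`-th side. -/
theorem det_sub_side_pos (i j : ZMod (2 * n)) (h1 : P j ≠ P i) (h2 : P j ≠ P (i + 1)) :
    0 < det2 (P.side i - P.side (i + n)) (P j - P i) := by
  by_cases hi : P.side i = 0
  · have := hP.outside (i + n) (by rw [add_half_add_half, hi]) j (by rwa [add_half_add_half])
    rw [add_half_add_half] at this
    rw [hi, zero_sub, det2_neg_left]
    linarith
  have hc := hP.convex i hi j h1 h2
  by_cases hi' : P.side (i + n) = 0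
  · rwa [hi', sub_zero]
  obtain ⟨t, ht, e⟩ := hP.exists_neg_smul hi hi'
  rw [e, det2_sub_left, det2_smul_left]
  nlinarith

theorem det_sub_side_nonneg (i j : ZMod (2 * n)) :
    0 ≤ det2 (P.side i - P.side (i + n)) (P j - P i) := by
  by_cases h1 : P j = P i
  · simp [h1, det2_zero_right]
  by_cases h2 : P j = P (i + 1)
  · have := hP.parallel i
    rw [h2, det2_sub_left]
    change 0 ≤ det2 (P.side i) (P.side i) - det2 (P.side (i + n)) (P.side i)
    rw [det2_self, det2_swap, this]
    simp
  exact (hP.det_sub_side_pos i j h1 h2).le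

theorem not_repeat_aux {i j : ZMod (2 * n)} (hij : j ≠ i) (h1 : P j = P i)
    (h2 : P (j + n) = P (i + n)) (hi : P.side i ≠ 0) : False := by
  have hj : P.side j = 0 := by
    by_contra hc
    exact hij (hP.once _ _ hc hi h1)
  have hj' : P.side (j + n) ≠ 0 := (hP.not_both_degenerate j).resolve_left (not_not_intro hj)
  have hi' : P.side (i + n) = 0 := by
    by_contra hc
    exact hij (add_right_cancel (hP.once _ _ hj' hc h2))
  have g1 := hP.outside i hi' (j + n + 1) (by
    rw [← h2]; exact fun hc => hj' (sub_eq_zero.2 hc))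
  have g2 := hP.outside (j + n) (by rw [add_half_add_half, hj]) (i + 1) (by
    rw [add_half_add_half, h1]; exact fun hc => hi (sub_eq_zero.2 hc))
  rw [← h2] at g1
  rw [add_half_add_half, h1] at g2
  change det2 (P.side i) (P.side (j + n)) < 0 at g1
  change det2 (P.side (j + n)) (P.side i) < 0 at g2
  rw [det2_swap] at g2
  linarith

/-- Distinct indices never carry the same pair of opposite vertices. -/
theorem not_repeat {i j : ZMod (2 * n)} (hij : j ≠ i) (h1 : P j = P i)
    (h2 : P (j + n) = P (i + n)) : False := by
  rcases hP.not_both_degenerate i with hi | hi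
  · exact hP.not_repeat_aux hij h1 h2 hi
  · exact hP.not_repeat_aux (i := i + n) (j := j + n) (fun hc => hij (add_right_cancel hc)) h2
      (by simpa only [add_half_add_half] using h1) hi

/-- No index other than `i` and `i + 1` carries the start of the `i`-th side together with the end of
the opposite side. -/
theorem not_cross {i j : ZMod (2 * n)} (h0 : j ≠ i) (h0' : j ≠ i + 1) (h1 : P j = P i)
    (h2 : P (j + n) = P (i + n + 1)) : False := by
  by_cases hi : P.side i = 0
  · exact hP.not_repeat h0' (h1.trans (sub_eq_zero.1 hi).symm)
      (by rw [h2, show i + n + 1 = i + 1 + n by ring])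
  by_cases hi' : P.side (i + n) = 0
  · exact hP.not_repeat h0 h1 (h2.trans (sub_eq_zero.1 hi'))
  have hj : P.side j = 0 := by
    by_contra hc
    exact h0 (hP.once _ _ hc hi h1)
  have hj' : P.side (j + n) ≠ 0 := (hP.not_both_degenerate j).resolve_left (not_not_intro hj)
  have g1 := hP.outside (j + n) (by rw [add_half_add_half, hj]) (i + 1) (by
    rw [add_half_add_half, h1]; exact fun hc => hi (sub_eq_zero.2 hc))
  rw [add_half_add_half, h1] at g1
  change det2 (P.side (j + n)) (P.side i) < 0 at g1
  have g2 := hP.det_nonneg hi' (j + n + 1)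
  obtain ⟨t, ht, e⟩ := hP.exists_neg_smul hi hi'
  rw [show P (j + n + 1) - P (i + n) = P.side (j + n) + P.side (i + n) by
    simp [side, h2], det2_add_right, det2_self, e, det2_smul_left, det2_swap] at g2
  nlinarith

theorem isBall_ball {a : ℝ} (ha : 0 < a) : IsBall (ball a P) where
  two_le := hP.two_le
  symm i := by
    simp only [ball, add_half_add_half]
    rw [← smul_neg, neg_sub]
  strict i j h1 h2 := by
    have e1 : (ball a P).side i = (1 / (2 * a)) • (P.side i - P.side (i + n)) := by
      simp only [side, ball]
      rw [← smul_sub, show i + 1 + n = i + n + 1 by ring]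
      congr 1; abel
    have e2 : ball a P j - ball a P i =
        (1 / (2 * a)) • ((P j - P i) - (P (j + n) - P (i + n))) := by
      simp only [ball]
      rw [← smul_sub]
      congr 1; abel
    rw [e1, e2, det2_smul_left, det2_smul_right]
    have ha' : 0 < 1 / (2 * a) := by positivity
    refine mul_pos ha' (mul_pos ha' ?_)
    have g1 := hP.det_sub_side_nonneg i j
    have g2 := hP.det_sub_side_nonneg (i + n) (j + n)
    have e3 : P.side (i + n) - P.side (i + n + n) = -(P.side i - P.side (i + n)) := by
      rw [add_half_add_half]; abel
    rw [e3, det2_neg_left] at g2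
    rw [det2_sub_right]
    by_contra! hc
    have c1 : P j = P i ∨ P j = P (i + 1) := by
      by_contra! hne
      have := hP.det_sub_side_pos i j hne.1 hne.2
      linarith
    have c2 : P (j + n) = P (i + n) ∨ P (j + n) = P (i + n + 1) := by
      by_contra! hne
      have := hP.det_sub_side_pos (i + n) (j + n) hne.1 hne.2
      rw [e3, det2_neg_left] at this
      linarith
    rcases c1 with c1 | c1 <;> rcases c2 with c2 | c2
    · exact hP.not_repeat h1 c1 c2
    · exact hP.not_cross h1 h2 c1 c2
    · refine hP.not_cross (i := i + n) (j := j + n) (fun hc => h1 (add_right_cancel hc))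
        (fun hc => h2 ?_) c2 (by simpa only [add_half_add_half] using c1)
      rw [show i + n + 1 = i + 1 + n by ring] at hc
      exact add_right_cancel hc
    · exact hP.not_repeat h2 c1 (by rw [c2, show i + n + 1 = i + 1 + n by ring])

end IsConvexWithParallelSides

/-! ### Constant width -/

namespace IsBall

variable {W : TwoNGon n} (h : IsBall W)
include h

/-- Writing an index as a translate of a given one by less than a full turn. -/
theorem exists_eq_add (m j : ZMod (2 * n)) : ∃ k < 2 * n, j = m + (k : ℕ) := by
  have hn := h.two_le
  have : NeZero (2 * n) := ⟨by omega⟩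
  refine ⟨(j - m).val, ZMod.val_lt _, ?_⟩
  rw [ZMod.natCast_zmod_val]; ring

/-- Over the half turn that starts at a vertex where `[·, v]` is maximal on `W`, all sides of `W`
point downwards. -/
theorem side_nonpos {v : Plane} {m : ZMod (2 * n)} (hm : ∀ j, det2 (W j) v ≤ det2 (W m) v)
    {k : ℕ} (hk : k < n) : det2 (W.side (m + k)) v ≤ 0 := by
  have hn := h.two_le
  have h0 : det2 (W.side m) v ≤ 0 := by
    have := hm (m + 1)
    simp only [side, det2_sub_left]; linarith
  have h1 : 0 ≤ det2 (W.side (m - 1)) v := by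
    have := hm (m - 1)
    simp only [side, det2_sub_left, sub_add_cancel]; linarith
  rcases Nat.eq_zero_or_pos k with rfl | hk0
  · simpa using h0
  rcases Nat.lt_or_ge (k + 1) n with hk1 | hk1
  · have hc := congrArg (det2 · v)
      (det2_cramer (W.side m) (W.side (m - 1)) (W.side (m + k)))
    simp only [det2_add_left, det2_smul_left] at hc
    have p1 := h.side_pos (m - 1)
    rw [sub_add_cancel, det2_swap] at p1
    have p2 := h.side_det_pos m hk0 hk
    have p3 := h.side_det_pos (m - 1) (k := k + 1) (by omega) hk1
    rw [show m - 1 + ((k + 1 : ℕ) : ZMod (2 * n)) = m + k by push_cast; ring, det2_swap] at p3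
    by_contra! hpos
    nlinarith [mul_nonneg p2.le h1, mul_nonneg (neg_nonneg.2 h0) p3.le, mul_pos hpos p1]
  · obtain rfl : n = k + 1 := by omega
    have := h.side_half (m - 1)
    rw [show m - 1 + ((k + 1 : ℕ) : ZMod (2 * (k + 1))) = m + k by push_cast; ring] at this
    rw [this, det2_neg_left]
    linarith

theorem vertex_le {A : TwoNGon n} (hA : HasNonnegSides W A) {v : Plane} {m : ZMod (2 * n)}
    (hm : ∀ j, det2 (W j) v ≤ det2 (W m) v) (j : ZMod (2 * n)) :
    det2 (A j) v ≤ det2 (A m) v := by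
  have hn := h.two_le
  have step : ∀ i, ∃ t : ℝ, 0 ≤ t ∧
      det2 (A (i + 1)) v - det2 (A i) v = t * det2 (W.side i) v := by
    intro i
    obtain ⟨t, ht, e⟩ := hA i
    exact ⟨t, ht, by rw [← det2_sub_left, e, det2_smul_left]; rfl⟩
  have down : ∀ k ≤ n, det2 (A (m + (k : ℕ))) v ≤ det2 (A m) v := by
    intro k
    induction k with
    | zero => simp
    | succ k ih =>
      intro hk
      obtain ⟨t, ht, e⟩ := step (m + k)
      have := mul_nonneg ht (neg_nonneg.2 (h.side_nonpos hm (k := k) (by omega)))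
      rw [show m + ((k + 1 : ℕ) : ZMod (2 * n)) = m + k + 1 by push_cast; ring]
      have := ih (by omega)
      linarith
  have up : ∀ k ≤ n, det2 (A (m - (k : ℕ))) v ≤ det2 (A m) v := by
    intro k
    induction k with
    | zero => simp
    | succ k ih =>
      intro hk
      obtain ⟨t, ht, e⟩ := step (m - (k + 1 : ℕ))
      have h1 := h.side_nonpos hm (k := n - (k + 1)) (by omega)
      have h2 := h.side_half (m - (k + 1 : ℕ))
      rw [Nat.cast_sub hk, show m + (n - (k + 1 : ℕ) : ZMod (2 * n)) =
        m - (k + 1 : ℕ) + n by ring, h2, det2_neg_left] at h1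
      have := mul_nonneg ht (neg_nonneg.2 h1)
      rw [show m - ((k + 1 : ℕ) : ZMod (2 * n)) + 1 = m - k by push_cast; ring] at e
      have := ih (by omega)
      linarith
  obtain ⟨k, hk, rfl⟩ := h.exists_eq_add m j
  rcases le_total k n with hkn | hkn
  · exact down k hkn
  · have := up (2 * n - k) (by omega)
    rw [Nat.cast_sub hk.le, ZMod.natCast_self] at this
    simpa using this

theorem supportFn_eq {A : TwoNGon n} {v : Plane} {m : ZMod (2 * n)}
    (hm : ∀ j, det2 (A j) v ≤ det2 (A m) v) : supportFn A v = det2 (A m) v := by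
  have hn := h.two_le
  have : NeZero (2 * n) := ⟨by omega⟩
  exact le_antisymm (ciSup_le hm)
    (le_ciSup (f := fun j => det2 (A j) v) (Set.finite_range _).bddAbove m)

theorem exists_max (v : Plane) : ∃ m, ∀ j, det2 (W j) v ≤ det2 (W m) v := by
  have hn := h.two_le
  have : NeZero (2 * n) := ⟨by omega⟩
  exact Finite.exists_max fun j => det2 (W j) v

/-- A convex polygon whose sides are those of `W` up to nonnegative factors attains its support
functions at the same indices as `W`, so its width is read off its diagonals. -/
theorem width_eq {A : TwoNGon n} {w : ℝ} (hA : HasNonnegSides W A)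
    (hd : ∀ i, A i - A (i + n) = w • W i) {v : Plane} (hv : supportFn W v = 1) :
    supportFn A v + supportFn A (-v) = w := by
  obtain ⟨m, hm⟩ := h.exists_max v
  have hm' : ∀ j, det2 (W j) (-v) ≤ det2 (W (m + n)) (-v) := by
    intro j
    have := hm (j + n)
    rw [h.symm, det2_neg_left] at this
    rw [h.symm, det2_neg_right, det2_neg_left, det2_neg_right]
    linarith
  rw [h.supportFn_eq (h.vertex_le hA hm), h.supportFn_eq (h.vertex_le hA hm')]
  rw [h.supportFn_eq hm] at hv
  rw [det2_neg_right, ← sub_eq_add_neg, ← det2_sub_left, hd, det2_smul_left, hv, mul_one]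

end IsBall

/-! ### Polygons of zero width, involutes and evolutes -/

/-- `A` is its own central equidistant: its sides are real multiples of those of `W`, and it is
traversed twice. These are the polygons, possibly with cusps, of constant `W`-width zero. -/
structure IsCentral (W A : TwoNGon n) : Prop where
  half : ∀ i, A (i + n) = A i
  side_eq : ∀ i, A.side i = ratio W A i • W.side i

namespace IsBall

variable {W A : TwoNGon n} (h : IsBall W)
include h

/-- Sides that are some multiples of those of `W` have the factors `ratio W A`. -/
theorem isCentral_of_exists (h1 : ∀ i, A (i + n) = A i)
    (h2 : ∀ i, ∃ t : ℝ, A.side i = t • W.side i) : IsCentral W A where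
  half := h1
  side_eq i := by
    obtain ⟨t, ht⟩ := h2 i
    rw [ratio_eq W A i t (h.pos i).ne' ht, ht]

theorem ratio_half (hA : IsCentral W A) (i : ZMod (2 * n)) :
    ratio W A (i + n) = -ratio W A i := by
  unfold ratio
  rw [show i + n + 1 = i + 1 + n by ring, h.symm, h.symm, hA.half, hA.half, det2_neg_left,
    det2_neg_left, det2_neg_right, neg_neg, neg_div]

theorem beta_succ (hA : IsCentral W A) (i : ZMod (2 * n)) :
    beta W A (i + 1) = beta W A i - ratio W A i * det2 (W i) (W (i + 1)) := by
  have e := Finset.sum_range_succ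
    (fun l : ℕ => ratio W A (i + l) * det2 (W (i + l)) (W (i + l + 1))) n
  rw [Finset.sum_range_succ'] at e
  simp only [Nat.cast_zero, add_zero] at e
  rw [h.ratio_half hA, show i + n + 1 = i + 1 + n by ring, h.symm, h.symm, det2_neg_left,
    det2_neg_right, neg_neg] at e
  unfold beta
  have : ∀ l : ℕ, i + 1 + (l : ZMod (2 * n)) = i + ((l + 1 : ℕ) : ZMod (2 * n)) := by
    intro l; push_cast; ring
  simp only [this]
  linarith

theorem beta_half (hA : IsCentral W A) (i : ZMod (2 * n)) :
    beta W A (i + n) = -beta W A i := by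
  unfold beta
  rw [← mul_neg, ← Finset.sum_neg_distrib]
  congr 1
  refine Finset.sum_congr rfl fun l _ => ?_
  rw [show i + n + (l : ZMod (2 * n)) = i + l + n by ring, h.ratio_half hA,
    show i + l + n + 1 = i + l + 1 + (n : ZMod (2 * n)) by ring, h.symm, h.symm, det2_neg_left,
    det2_neg_right]
  ring

theorem side_involute (hA : IsCentral W A) (i : ZMod (2 * n)) :
    (involute W A).side i = beta W A (i + 1) • (dual W).side i := by
  have e : A (i + 1) = A i + (ratio W A i * det2 (W i) (W (i + 1))) • dual W i := by
    rw [mul_smul, ← h.side_eq, ← hA.side_eq]; simp [side]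
  simp only [side, involute, e, h.beta_succ hA]
  module

theorem isCentral_involute (hA : IsCentral W A) : IsCentral (dual W) (involute W A) :=
  h.isBall_dual.isCentral_of_exists
    (fun i => by
      simp only [involute]
      rw [hA.half, h.beta_half hA, h.dual_symm, neg_smul_neg])
    fun i => ⟨_, h.side_involute hA i⟩

theorem ratio_involute (hA : IsCentral W A) (i : ZMod (2 * n)) :
    ratio (dual W) (involute W A) i = beta W A (i + 1) :=
  ratio_eq _ _ _ _ (h.dual_pos i).ne' (h.side_involute hA i)

theorem isCentral_evolute (hA : IsCentral W A) : IsCentral (dual W) (evolute W A) := by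
  refine h.isBall_dual.isCentral_of_exists (fun i => ?_) fun i => ?_
  · simp only [evolute]
    rw [hA.half, h.ratio_half hA, h.symm, neg_smul_neg]
  · have e : (evolute W A).side i = (ratio W A i - ratio W A (i + 1)) • W (i + 1) := by
      have e : A (i + 1) = A i + ratio W A i • (W (i + 1) - W i) := by
        rw [← side, ← hA.side_eq]; simp [side]
      simp only [side, evolute, e]
      module
    refine ⟨-(ratio W A i - ratio W A (i + 1)) *
      (det2 (dual W i) (dual W (i + 1)))⁻¹, ?_⟩
    rw [e, h.dual_side, mul_smul, smul_neg, inv_smul_smul₀ (h.dual_pos i).ne', neg_smul_neg]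

/-- Since the second dual of `W` is `-W` with the index raised by one, a polygon of zero width for
the second dual has zero width for `W` once its index is lowered by one. -/
theorem isCentral_pred (hA : IsCentral (dual (dual W)) A) : IsCentral W fun i => A (i - 1) := by
  refine h.isCentral_of_exists (fun i => ?_) fun i => ⟨-ratio (dual (dual W)) A (i - 1), ?_⟩
  · rw [show i + n - 1 = i - 1 + (n : ZMod (2 * n)) by ring, hA.half]
  · have := hA.side_eq (i - 1)
    simp only [side, h.dual_dual, sub_add_cancel] at this ⊢
    rw [add_sub_cancel_right, this]
    module

theorem ratio_pred (i : ZMod (2 * n)) :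
    ratio W (fun i => A (i - 1)) i = -ratio (dual (dual W)) A (i - 1) := by
  unfold ratio
  simp only [h.dual_dual, sub_add_cancel, det2_neg_left, det2_neg_right, neg_neg,
    add_sub_cancel_right]
  rw [neg_div, neg_neg]

theorem hasConstantWidth (hA : IsCentral W A) (c : ℝ) :
    HasConstantWidth W (equidistant W A c) (2 * c) := by
  have hd : ∀ i, equidistant W A c i - equidistant W A c (i + n) = (2 * c) • W i := by
    intro i
    simp only [equidistant, h.symm, hA.half]
    module
  refine ⟨fun i => ⟨ratio W A i + c, ?_⟩, hd, fun hs v hv => h.width_eq hs hd hv⟩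
  have := hA.side_eq i
  simp only [side] at this
  rw [add_smul, ← this]
  simp only [equidistant]
  module

end IsBall

theorem IsConvexWithParallelSides.isCentral_centralEquidistant {P : TwoNGon n}
    (hP : P.IsConvexWithParallelSides) {a : ℝ} (ha : 0 < a) :
    IsCentral (ball a P) (centralEquidistant P) := by
  refine (hP.isBall_ball ha).isCentral_of_exists (fun i => ?_) fun i => ?_
  · simp only [centralEquidistant, add_half_add_half]
    rw [add_comm]
  · have e1 : (centralEquidistant P).side i = (1 / 2 : ℝ) • (P.side i + P.side (i + n)) := by
      simp only [centralEquidistant, side]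
      rw [show i + 1 + n = i + n + 1 by ring]
      module
    have e2 : P.side i - P.side (i + n) = (2 * a) • (ball a P).side i := by
      simp only [ball, side]
      rw [show i + 1 + n = i + n + 1 by ring, ← smul_sub, smul_smul,
        mul_one_div_cancel (by positivity), one_smul]
      module
    have hne : P.side i - P.side (i + n) ≠ 0 := by
      intro hc
      rw [hc] at e2
      have h0 := (smul_eq_zero.1 e2.symm).resolve_left (by positivity)
      have := (hP.isBall_ball ha).side_pos i
      rw [h0, det2_zero_left] at this
      exact this.false
    have hd : det2 (P.side i - P.side (i + n)) (P.side i + P.side (i + n)) = 0 := by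
      have := hP.parallel i
      rw [det2_sub_left, det2_add_right, det2_add_right, det2_self, det2_self,
        det2_swap (P.side (i + n)), this]
      simp
    obtain ⟨t, ht⟩ := exists_smul_of_det2_eq_zero hne hd
    exact ⟨1 / 2 * t * (2 * a), by rw [e1, ht, e2]; module⟩

/-! ### The iterated involutes -/

/-- Two successive involutes, with the index lowered so that the vertices are again labelled as
those of `W`. -/
noncomputable def doubleInvolute (W A : TwoNGon n) : TwoNGon n :=
  fun i => involute (dual W) (involute W A) (i - 1)

theorem iterM_succ (a : ℝ) (P : TwoNGon n) (k : ℕ) :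
    iterM a P (k + 1) = doubleInvolute (ball a P) (iterM a P k) := rfl

theorem IsBall.isCentral_doubleInvolute {W A : TwoNGon n} (h : IsBall W) (hA : IsCentral W A) :
    IsCentral W (doubleInvolute W A) :=
  h.isCentral_pred (h.isBall_dual.isCentral_involute (h.isCentral_involute hA))

theorem IsConvexWithParallelSides.isCentral_iterM {P : TwoNGon n}
    (hP : P.IsConvexWithParallelSides) {a : ℝ} (ha : 0 < a) (k : ℕ) :
    IsCentral (ball a P) (iterM a P k) := by
  induction k with
  | zero => exact hP.isCentral_centralEquidistant ha
  | succ k ih => exact (hP.isBall_ball ha).isCentral_doubleInvolute ih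

theorem IsConvexWithParallelSides.isCentral_iterN {P : TwoNGon n}
    (hP : P.IsConvexWithParallelSides) {a : ℝ} (ha : 0 < a) (k : ℕ) :
    IsCentral (dual (ball a P)) (iterN a P k) := by
  cases k with
  | zero => exact (hP.isBall_ball ha).isCentral_evolute (hP.isCentral_centralEquidistant ha)
  | succ k => exact (hP.isBall_ball ha).isCentral_involute (hP.isCentral_iterM ha k)

/-! ### A discrete Wirtinger inequality -/

/-- Picone's identity, summed: a positive solution `f` of a discrete Jacobi equation makes the
corresponding quadratic form positive definite on sequences that vanish at both ends. -/
theorem picone {n : ℕ} (hn : 2 ≤ n) {f e w v : ℕ → ℝ} (hw : ∀ l, 0 < w l)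
    (hf : ∀ l, 0 < l → l < n → 0 < f l) (hfn : f n = 0)
    (hrec : ∀ l, v l * f (l + 1) =
      (f (l + 1) - f l) / w l - (f (l + 2) - f (l + 1)) / w (l + 1))
    (e1 : e 1 = 0) (en : e n = 0) :
    0 ≤ ∑ l ∈ Finset.range (n - 1),
        ((e (l + 2) - e (l + 1)) ^ 2 / w (l + 1) - v l * e (l + 1) ^ 2) ∧
      (∑ l ∈ Finset.range (n - 1),
        ((e (l + 2) - e (l + 1)) ^ 2 / w (l + 1) - v l * e (l + 1) ^ 2) = 0 →
          ∀ l < n, 0 < l → e l = 0) := by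
  -- each partial sum, less a boundary term, is a sum of squares of differences of `e / f`
  set S : ℕ → ℝ := fun j => ∑ l ∈ Finset.range j,
    ((e (l + 2) - e (l + 1)) ^ 2 / w (l + 1) - v l * e (l + 1) ^ 2) with hS
  have key : ∀ j, j + 1 < n →
      0 ≤ S j - e (j + 1) ^ 2 * ((f (j + 1) - f j) / (w j * f (j + 1))) ∧
      (S j - e (j + 1) ^ 2 * ((f (j + 1) - f j) / (w j * f (j + 1))) = 0 →
        ∀ l ≤ j, e (l + 1) = 0) := by
    intro j
    induction j with
    | zero =>
      intro _
      simp [hS, e1]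
    | succ j ih =>
      intro hj
      obtain ⟨ih1, ih2⟩ := ih (by omega)
      have f1 := hf (j + 1) (by omega) (by omega)
      have f2 := hf (j + 2) (by omega) (by omega)
      have w0 := hw j
      have w1 := hw (j + 1)
      have hv : v j = ((f (j + 1) - f j) / w j - (f (j + 2) - f (j + 1)) / w (j + 1)) /
          f (j + 1) := by rw [← hrec, mul_div_cancel_right₀ _ f1.ne']
      have id : S (j + 1) - e (j + 1 + 1) ^ 2 *
          ((f (j + 1 + 1) - f (j + 1)) / (w (j + 1) * f (j + 1 + 1))) =
          (S j - e (j + 1) ^ 2 * ((f (j + 1) - f j) / (w j * f (j + 1)))) +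
          f (j + 1) * f (j + 2) / w (j + 1) *
            (e (j + 2) / f (j + 2) - e (j + 1) / f (j + 1)) ^ 2 := by
        have : S (j + 1) = S j +
          ((e (j + 2) - e (j + 1)) ^ 2 / w (j + 1) - v j * e (j + 1) ^ 2) :=
          Finset.sum_range_succ _ _
        rw [this, hv]
        simp only [show j + 1 + 1 = j + 2 from rfl]
        field_simp
        ring
      have hsq : 0 ≤ f (j + 1) * f (j + 2) / w (j + 1) *
            (e (j + 2) / f (j + 2) - e (j + 1) / f (j + 1)) ^ 2 := by positivity
      rw [id]
      refine ⟨by linarith, fun h0 => ?_⟩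
      have z := ih2 (by linarith)
      have hz : f (j + 1) * f (j + 2) / w (j + 1) *
            (e (j + 2) / f (j + 2) - e (j + 1) / f (j + 1)) ^ 2 = 0 := by linarith
      have hz' := pow_eq_zero_iff (two_ne_zero) |>.1
        ((mul_eq_zero.1 hz).resolve_left (by positivity))
      rw [z j le_rfl, zero_div, sub_zero, div_eq_zero_iff] at hz'
      intro l hl
      rcases Nat.lt_or_ge l (j + 1) with hl' | hl'
      · exact z l (by omega)
      · obtain rfl : l = j + 1 := by omega
        exact hz'.resolve_right f2.ne'
  obtain ⟨m, rfl⟩ : ∃ m, n = m + 2 := ⟨n - 2, by omega⟩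
  have f1 := hf (m + 1) (by omega) (by omega)
  have w0 := hw m
  have w1 := hw (m + 1)
  have last : S (m + 1) =
      S m - e (m + 1) ^ 2 * ((f (m + 1) - f m) / (w m * f (m + 1))) := by
    have hv : v m = ((f (m + 1) - f m) / w m - (f (m + 2) - f (m + 1)) / w (m + 1)) /
        f (m + 1) := by rw [← hrec, mul_div_cancel_right₀ _ f1.ne']
    have : S (m + 1) = S m +
        ((e (m + 2) - e (m + 1)) ^ 2 / w (m + 1) - v m * e (m + 1) ^ 2) :=
      Finset.sum_range_succ _ _
    rw [this, hv, hfn, en]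
    field_simp
    ring
  change 0 ≤ S (m + 1) ∧ (S (m + 1) = 0 → _)
  rw [last]
  obtain ⟨k1, k2⟩ := key m (by omega)
  refine ⟨k1, fun h0 l hl hl0 => ?_⟩
  obtain ⟨l, rfl⟩ : ∃ l', l = l' + 1 := ⟨l - 1, by omega⟩
  exact k2 h0 l (by omega)

/-- The coordinate functions of `W` solve a discrete Jacobi equation. -/
theorem IsBall.jacobi {W : TwoNGon n} (h : IsBall W) (u : Plane) (i : ZMod (2 * n)) :
    det2 (dual W i) (dual W (i + 1)) * det2 (W (i + 1)) u =
      (det2 (W (i + 1)) u - det2 (W i) u) / det2 (W i) (W (i + 1)) -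
      (det2 (W (i + 1 + 1)) u - det2 (W (i + 1)) u) / det2 (W (i + 1)) (W (i + 1 + 1)) := by
  have e := congrArg (det2 · u) (h.dual_side i)
  simp only [side, det2_neg_left, det2_smul_left, det2_sub_left] at e
  rw [dual_eq W i, dual_eq W (i + 1)] at e ⊢
  simp only [side, det2_smul_left, det2_sub_left] at e ⊢
  rw [div_eq_inv_mul, div_eq_inv_mul]
  linarith

section Sums

variable {R : Type*} [CommRing R] [NeZero (2 * n)]

theorem sum_eq_sum_range (F : ZMod (2 * n) → R) (m : ZMod (2 * n)) :
    ∑ i, F i = ∑ l ∈ Finset.range (2 * n), F (m + l) := by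
  rw [← Equiv.sum_comp (Equiv.addLeft m)]
  refine (Finset.sum_nbij (fun l : ℕ => (l : ZMod (2 * n))) (fun _ _ => Finset.mem_univ _)
    (fun k hk l hl hkl => ?_) (fun i _ => ?_) fun _ _ => rfl).symm
  · exact natCast_inj_of_lt (by simpa using hk) (by simpa using hl) hkl
  · exact ⟨i.val, by simpa using ZMod.val_lt i, ZMod.natCast_zmod_val i⟩

theorem sum_eq_two_mul_sum_range (F : ZMod (2 * n) → R) (hF : ∀ i, F (i + n) = F i)
    (m : ZMod (2 * n)) : ∑ i, F i = 2 * ∑ l ∈ Finset.range n, F (m + l) := by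
  rw [sum_eq_sum_range F m, congrArg (fun k => ∑ l ∈ Finset.range k, F (m + (l : ZMod (2 * n))))
    (two_mul n), Finset.sum_range_add]
  refine Eq.trans ?_ (two_mul _).symm
  congr 1
  refine Finset.sum_congr rfl fun l _ => ?_
  rw [← hF (m + l)]
  congr 1
  push_cast; ring

theorem sum_shift (F : ZMod (2 * n) → R) : ∑ i, F (i + 1) = ∑ i, F i :=
  Equiv.sum_comp (Equiv.addRight 1) F

namespace IsBall

variable {W : TwoNGon n} (h : IsBall W)
include h

/-- The discrete Wirtinger inequality attached to a unit ball, with its equality case. Subtracting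
from `b` the coordinate function of `W` with the same values at `0` and `1`, which lies in the
kernel of the quadratic form, reduces it to sequences with zero boundary values. -/
theorem wirtinger {b : ZMod (2 * n) → ℝ} (hb : ∀ i, b (i + n) = -b i) :
    ∑ i, det2 (dual W i) (dual W (i + 1)) * b (i + 1) ^ 2 ≤
        ∑ i, (b (i + 1) - b i) ^ 2 / det2 (W i) (W (i + 1)) ∧
      (∑ i, det2 (dual W i) (dual W (i + 1)) * b (i + 1) ^ 2 =
        ∑ i, (b (i + 1) - b i) ^ 2 / det2 (W i) (W (i + 1)) → ∃ u, ∀ i, b i = det2 (W i) u) := by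
  have hn := h.two_le
  set w : ZMod (2 * n) → ℝ := fun i => det2 (W i) (W (i + 1)) with hw
  set v : ZMod (2 * n) → ℝ := fun i => det2 (dual W i) (dual W (i + 1)) with hv
  change ∑ i, v i * b (i + 1) ^ 2 ≤ ∑ i, (b (i + 1) - b i) ^ 2 / w i ∧
    (∑ i, v i * b (i + 1) ^ 2 = ∑ i, (b (i + 1) - b i) ^ 2 / w i → ∃ u, ∀ i, b i = det2 (W i) u)
  have w0 : ∀ i, 0 < w i := h.pos
  set u : Plane := (w 0)⁻¹ • (b 0 • W 1 - b 1 • W 0) with hu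
  set f : ZMod (2 * n) → ℝ := fun i => det2 (W i) u with hf
  set e : ZMod (2 * n) → ℝ := fun i => b i - f i with he
  have hww : w 0 = det2 (W 0) (W 1) := by simp [hw]
  have he0 : e 0 = 0 := by
    simp only [he, hf, hu, det2_smul_right, det2_sub_right, det2_self, ← hww]
    field_simp [(w0 0).ne']
    ring
  have he1 : e 1 = 0 := by
    simp only [he, hf, hu, det2_smul_right, det2_sub_right, det2_self, det2_swap (W 1) (W 0),
      ← hww]
    field_simp [(w0 0).ne']
    ring
  have hjac : ∀ i, v i * f (i + 1) =
      (f (i + 1) - f i) / w i - (f (i + 1 + 1) - f (i + 1)) / w (i + 1) := h.jacobi u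
  have hfn : ∀ i, f (i + n) = -f i := fun i => by simp only [hf, h.symm, det2_neg_left]
  have hen : ∀ i, e (i + n) = -e i := fun i => by simp only [he, hb, hfn]; ring
  have hwn : ∀ i, w (i + n) = w i := fun i => by
    simp only [hw]
    rw [show i + n + 1 = i + 1 + n by ring, h.symm, h.symm, det2_neg_left, det2_neg_right, neg_neg]
  have hvn : ∀ i, v (i + n) = v i := fun i => by
    simp only [hv]
    rw [show i + n + 1 = i + 1 + n by ring, h.dual_symm, h.dual_symm, det2_neg_left,
      det2_neg_right, neg_neg]
  -- the form is unchanged when `f` is removed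
  have red : ∑ i, ((b (i + 1) - b i) ^ 2 / w i - v i * b (i + 1) ^ 2) =
      ∑ i, ((e (i + 1 + 1) - e (i + 1)) ^ 2 / w (i + 1) - v i * e (i + 1) ^ 2) := by
    have s1 := sum_shift fun i => (e (i + 1) - e i) ^ 2 / w i
    have s3 := sum_shift fun i => (f i + 2 * e i) * (f (i + 1) - f i) / w i
    have t : ∑ i, ((f (i + 1) + 2 * e (i + 1)) * (f (i + 1) - f i) / w i
        - (f i + 2 * e i) * (f (i + 1) - f i) / w i
        - v i * f (i + 1) * (f (i + 1) + 2 * e (i + 1))) = 0 := by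
      simp only [hjac]
      rw [Finset.sum_sub_distrib, Finset.sum_sub_distrib, ← s3]
      rw [← Finset.sum_sub_distrib, ← Finset.sum_sub_distrib]
      refine Finset.sum_eq_zero fun i _ => ?_
      ring
    rw [Finset.sum_sub_distrib (s := Finset.univ)
      (f := fun i => (e (i + 1 + 1) - e (i + 1)) ^ 2 / w (i + 1)), s1, ← Finset.sum_sub_distrib,
      ← sub_eq_zero, ← Finset.sum_sub_distrib, ← t]
    refine Finset.sum_congr rfl fun i _ => ?_
    simp only [he]
    ring
  have hhalf := sum_eq_two_mul_sum_range
    (fun i => (e (i + 1 + 1) - e (i + 1)) ^ 2 / w (i + 1) - v i * e (i + 1) ^ 2) (fun i => by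
      simp only [show ∀ i : ZMod (2 * n), i + n + 1 = i + 1 + n from fun i => by ring, hen, hwn,
        hvn]
      ring) 0
  obtain ⟨m, rfl⟩ : ∃ m, n = m + 1 := ⟨n - 1, by omega⟩
  have henn : e ((m + 1 : ℕ) : ZMod (2 * (m + 1))) = 0 := by
    have := hen 0
    rwa [zero_add, he0, neg_zero] at this
  have henn1 : e (((m + 1 : ℕ) : ZMod (2 * (m + 1))) + 1) = 0 := by
    have := hen 1
    rwa [add_comm, he1, neg_zero] at this
  have pic := picone (n := m + 1) hn (f := fun l => det2 (W 0) (W (l : ℕ)))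
    (e := fun l => e (l : ℕ)) (w := fun l => w (l : ℕ)) (v := fun l => v (l : ℕ))
    (fun l => w0 _) (fun l h0 hl => by simpa using h.det_pos 0 h0 hl)
    (by
      have := h.symm 0
      rw [zero_add] at this
      simp only [this, det2_neg_right, det2_self, neg_zero])
    (fun l => by
      have := h.jacobi (W 0) (l : ZMod (2 * (m + 1)))
      have c1 : ((l + 1 : ℕ) : ZMod (2 * (m + 1))) = l + 1 := by push_cast; ring
      have c2 : ((l + 2 : ℕ) : ZMod (2 * (m + 1))) = l + 1 + 1 := by push_cast; ring
      simp only [c1, c2, det2_swap (W 0)]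
      simp only [hv, hw]
      linear_combination -this)
    (by simpa using he1) henn
  rw [Finset.sum_range_succ] at hhalf
  simp only [Nat.add_sub_cancel, zero_add] at hhalf pic
  have c1 : ∀ l : ℕ, ((l + 1 : ℕ) : ZMod (2 * (m + 1))) = l + 1 := by intro l; push_cast; ring
  rw [c1] at henn henn1
  have z : ∀ x y : ℝ, ((0 : ℝ) - 0) ^ 2 / x - y * 0 ^ 2 = 0 := by intro x y; simp
  rw [henn, henn1, z, add_zero] at hhalf
  simp only [c1] at pic
  rw [Finset.sum_sub_distrib] at red
  constructor
  · have := pic.1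
    linarith
  · intro heq
    refine ⟨u, ?_⟩
    have hz := pic.2 (by linarith)
    have hz' : ∀ l ≤ m, e (l : ZMod (2 * (m + 1))) = 0 := by
      intro l hl
      rcases Nat.eq_zero_or_pos l with rfl | h0
      · simpa using he0
      · exact hz l (by omega) h0
    intro i
    rw [← sub_eq_zero]
    change e i = 0
    obtain ⟨k, hk, rfl⟩ := h.exists_eq_add 0 i
    rw [zero_add]
    rcases Nat.lt_or_ge k (m + 1) with hk' | hk'
    · exact hz' k (by omega)
    · obtain ⟨l, rfl⟩ := Nat.exists_eq_add_of_le' hk'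
      rw [Nat.cast_add, hen, hz' l (by omega), neg_zero]

end IsBall

/-! ### Involutes decrease the energy -/

/-- The weighted sum of squares of the side ratios of `A`. -/
noncomputable def energy (W A : TwoNGon n) : ℝ := ∑ i, det2 (W i) (W (i + 1)) * ratio W A i ^ 2

namespace IsBall

variable {W A : TwoNGon n} (h : IsBall W)
include h

theorem energy_nonneg (A : TwoNGon n) : 0 ≤ energy W A :=
  Finset.sum_nonneg fun i _ => mul_nonneg (h.pos i).le (sq_nonneg _)

/-- In the equality case of the Wirtinger inequality the side ratios are `-[V_i, u]`; as the sides
of `A` sum to zero, they vanish. -/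
theorem energy_involute (hA : IsCentral W A) :
    energy (dual W) (involute W A) ≤ energy W A ∧
      (energy (dual W) (involute W A) = energy W A → ∀ i, ratio W A i = 0) := by
  have e1 : energy (dual W) (involute W A) =
      ∑ i, det2 (dual W i) (dual W (i + 1)) * beta W A (i + 1) ^ 2 :=
    Finset.sum_congr rfl fun i _ => by rw [h.ratio_involute hA]
  have e2 : energy W A =
      ∑ i, (beta W A (i + 1) - beta W A i) ^ 2 / det2 (W i) (W (i + 1)) :=
    Finset.sum_congr rfl fun i _ => by
      have := (h.pos i).ne'
      rw [h.beta_succ hA]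
      field_simp
      ring
  rw [e1, e2]
  obtain ⟨g1, g2⟩ := h.wirtinger (h.beta_half hA)
  refine ⟨g1, fun heq => ?_⟩
  obtain ⟨u, hu⟩ := g2 heq
  have hr : ∀ i, ratio W A i = -det2 (dual W i) u := by
    intro i
    have b := h.beta_succ hA i
    rw [hu, hu] at b
    apply mul_right_cancel₀ (h.pos i).ne'
    have s := congrArg (det2 · u) (h.side_eq i)
    simp only [side, det2_sub_left, det2_smul_left] at s
    linarith
  have hsum : ∑ i, det2 (A.side i) u = 0 := by
    simp only [side, det2_sub_left]
    rw [Finset.sum_sub_distrib, sum_shift fun i => det2 (A i) u, sub_self]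
  have hsum' : energy W A = 0 := by
    rw [← neg_eq_zero, ← hsum, energy, ← Finset.sum_neg_distrib]
    refine Finset.sum_congr rfl fun i _ => ?_
    rw [hA.side_eq, h.side_eq, det2_smul_left, det2_smul_left, hr i]
    ring
  intro i
  have := (Finset.sum_eq_zero_iff_of_nonneg fun i _ =>
    mul_nonneg (h.pos i).le (sq_nonneg (ratio W A i))).1 hsum' i (Finset.mem_univ i)
  exact pow_eq_zero_iff two_ne_zero |>.1 ((mul_eq_zero.1 this).resolve_left (h.pos i).ne')

theorem energy_pred : energy W (fun i => A (i - 1)) = energy (dual (dual W)) A := by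
  unfold energy
  rw [← sum_shift]
  refine Finset.sum_congr rfl fun i _ => ?_
  rw [h.ratio_pred, add_sub_cancel_right, h.dual_dual, h.dual_dual, det2_neg_left,
    det2_neg_right]
  ring

theorem energy_doubleInvolute (hA : IsCentral W A) :
    energy W (doubleInvolute W A) ≤ energy W A ∧
      (energy W (doubleInvolute W A) = energy W A → ∀ i, ratio W A i = 0) := by
  have g1 := h.energy_involute hA
  have g2 := h.isBall_dual.energy_involute (h.isCentral_involute hA)
  have e := h.energy_pred (A := involute (dual W) (involute W A))
  change energy W (doubleInvolute W A) = _ at e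
  rw [e]
  exact ⟨g2.1.trans g1.1, fun heq => g1.2 (le_antisymm g1.1 (heq ▸ g2.1))⟩

end IsBall

end Sums

/-! ### Regions bounded by closed polygonal arcs -/

theorem mem_arc (A : TwoNGon n) (i : ZMod (2 * n)) : A i ∈ arc A :=
  Set.mem_iUnion.2 ⟨i, left_mem_segment ℝ _ _⟩

theorem arc_pred (A : TwoNGon n) : arc (fun i => A (i - 1)) = arc A := by
  unfold arc
  rw [← (Equiv.addRight (1 : ZMod (2 * n))).surjective.iUnion_comp]
  simp only [Equiv.coe_addRight, add_sub_cancel_right]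

theorem arc_subset_of_convex {A : TwoNGon n} {K : Set Plane} (hK : Convex ℝ K)
    (hA : ∀ i, A i ∈ K) : arc A ⊆ K :=
  Set.iUnion_subset fun i => hK.segment_subset (hA i) (hA (i + 1))

theorem arc_subset_region (A : TwoNGon n) : arc A ⊆ region A := by
  intro x hx hc
  obtain ⟨y, -, hy⟩ := hc 0
  exact hy.source_mem hx

theorem isCompact_arc [NeZero (2 * n)] (A : TwoNGon n) : IsCompact (arc A) := by
  refine isCompact_iUnion fun i => ?_
  rw [segment_eq_image']
  exact isCompact_Icc.image (by fun_prop)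

theorem region_subset_of_arc_subset {A B : TwoNGon n} (h : arc B ⊆ region A) :
    region B ⊆ region A := by
  intro x hx
  by_contra hxA
  have hxA' : ∀ R : ℝ, ∃ y : Plane, R < ‖y‖ ∧ JoinedIn (arc A)ᶜ x y := not_not.1 hxA
  have hx0 : x ∈ (arc A)ᶜ := fun hc => hxA (arc_subset_region A hc)
  have hC : pathComponentIn (arc A)ᶜ x ⊆ (arc B)ᶜ := by
    intro z hz hzB
    refine h hzB fun R => ?_
    obtain ⟨y, hy, hxy⟩ := hxA' R
    exact ⟨y, hy, (JoinedIn.symm hz).trans hxy⟩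
  refine hx fun R => ?_
  obtain ⟨y, hy, hxy⟩ := hxA' R
  exact ⟨y, hy, ((isPathConnected_pathComponentIn hx0).joinedIn x
    (mem_pathComponentIn_self hx0) y hxy).mono hC⟩

theorem isClosed_region [NeZero (2 * n)] (A : TwoNGon n) : IsClosed (region A) := by
  rw [← isOpen_compl_iff, Metric.isOpen_iff]
  intro x hx
  have hx' : ∀ R : ℝ, ∃ y : Plane, R < ‖y‖ ∧ JoinedIn (arc A)ᶜ x y := not_not.1 hx
  have hx0 : x ∈ (arc A)ᶜ := fun hc => hx (arc_subset_region A hc)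
  obtain ⟨ε, hε, hb⟩ := Metric.isOpen_iff.1 (isCompact_arc A).isClosed.isOpen_compl x hx0
  refine ⟨ε, hε, fun z hz hc => hc fun R => ?_⟩
  obtain ⟨y, hy, hxy⟩ := hx' R
  refine ⟨y, hy, JoinedIn.trans ?_ hxy⟩
  exact JoinedIn.of_segment_subset
    (((convex_ball x ε).segment_subset hz (Metric.mem_ball_self hε)).trans hb)

theorem region_subset_closedBall {A : TwoNGon n} {c : Plane} {r : ℝ}
    (hA : ∀ i, A i ∈ Metric.closedBall c r) : region A ⊆ Metric.closedBall c r := by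
  intro x hx
  by_contra hxr
  rw [Metric.mem_closedBall, not_le, dist_eq_norm] at hxr
  rcases lt_or_ge r 0 with hr | hr
  · have := (Metric.mem_closedBall.1 (hA 0)).trans_lt hr
    exact absurd dist_nonneg (not_le.2 this)
  have hx0 : 0 < ‖x - c‖ := hr.trans_lt hxr
  -- the ray from `x` away from the centre avoids the ball
  refine hx fun R => ⟨c + (1 + (|R| + ‖c‖ + 1) / ‖x - c‖) • (x - c), ?_, ?_⟩
  · have h1 : ‖(1 + (|R| + ‖c‖ + 1) / ‖x - c‖) • (x - c)‖ = ‖x - c‖ + (|R| + ‖c‖ + 1) := by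
      rw [norm_smul, Real.norm_of_nonneg (by positivity)]
      field_simp
    have h2 := norm_sub_le (c + (1 + (|R| + ‖c‖ + 1) / ‖x - c‖) • (x - c)) c
    rw [add_sub_cancel_left, h1] at h2
    have := le_abs_self R
    linarith
  · refine JoinedIn.of_segment_subset fun z hz hzA => ?_
    have hzr := arc_subset_of_convex (convex_closedBall c r) hA hzA
    rw [segment_eq_image'] at hz
    obtain ⟨θ, ⟨hθ, -⟩, rfl⟩ := hz
    have e : x + θ • (c + (1 + (|R| + ‖c‖ + 1) / ‖x - c‖) • (x - c) - x) - c =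
        (1 + θ * ((|R| + ‖c‖ + 1) / ‖x - c‖)) • (x - c) := by module
    rw [Metric.mem_closedBall, dist_eq_norm, e, norm_smul,
      Real.norm_of_nonneg (by positivity)] at hzr
    have : 0 ≤ θ * ((|R| + ‖c‖ + 1) / ‖x - c‖) := by positivity
    nlinarith

/-! ### Sign changes of cyclic sequences -/

section Signs

variable [NeZero (2 * n)]

/-- The sum of the products of the signs of neighbouring terms. For a sequence without zeros this
is `2n` minus twice the number of sign changes. -/
noncomputable def signCorrelation (g : ZMod (2 * n) → ℝ) : ℤ :=
  ∑ i, (SignType.sign (g i) : ℤ) * (SignType.sign (g (i + 1)) : ℤ)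

/-- Changing a term that vanishes between opposite neighbours does not affect the correlation. -/
theorem sum_mul_succ_eq {s t : ZMod (2 * n) → ℤ} (h1 : ∀ i, s i ≠ 0 → t i = s i)
    (h2 : ∀ i, s i = 0 → s (i - 1) + s (i + 1) = 0 ∧ s (i + 1) ≠ 0) :
    ∑ i, t i * t (i + 1) = ∑ i, s i * s (i + 1) := by
  have sh := sum_shift fun i => s (i - 1) * (t i - s i)
  simp only [add_sub_cancel_right] at sh
  rw [← sub_eq_zero, ← Finset.sum_sub_distrib]
  calc ∑ i, (t i * t (i + 1) - s i * s (i + 1))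
      = ∑ i, (t i - s i) * (s (i + 1) + (t (i + 1) - s (i + 1))) +
          ∑ i, s i * (t (i + 1) - s (i + 1)) := by
        rw [← Finset.sum_add_distrib]
        exact Finset.sum_congr rfl fun i _ => by ring
    _ = ∑ i, (t i - s i) * (s (i - 1) + s (i + 1) + (t (i + 1) - s (i + 1))) := by
        rw [sh, ← Finset.sum_add_distrib]
        exact Finset.sum_congr rfl fun i _ => by ring
    _ = 0 := by
        refine Finset.sum_eq_zero fun i _ => ?_
        by_cases hs : s i = 0
        · rw [(h2 i hs).1, h1 _ (h2 i hs).2, sub_self, add_zero, mul_zero]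
        · rw [h1 i hs, sub_self, zero_mul]

/-- The sign correlation is constant along connected families in which terms only vanish between
neighbours of opposite signs. -/
theorem signCorrelation_eq_of_isPreconnected {X : Type*} [TopologicalSpace X] {T : Set X}
    (hT : IsPreconnected T) {g : X → ZMod (2 * n) → ℝ} (hg : ∀ i, ContinuousOn (fun x => g x i) T)
    (hz : ∀ x ∈ T, ∀ i, g x i = 0 → g x (i - 1) * g x (i + 1) < 0) {x y : X} (hx : x ∈ T)
    (hy : y ∈ T) : signCorrelation (g x) = signCorrelation (g y) := by
  refine hT.constant (f := fun x => signCorrelation (g x)) (fun x hx => ?_) hx hy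
  have hev : ∀ᶠ y in 𝓝[T] x, ∀ i, g x i ≠ 0 →
      SignType.sign (g y i) = SignType.sign (g x i) := by
    refine eventually_all.2 fun i => ?_
    rcases lt_trichotomy (g x i) 0 with h | h | h
    · filter_upwards [(hg i x hx).eventually (gt_mem_nhds h)] with y hy _
      rw [sign_neg hy, sign_neg h]
    · exact Eventually.of_forall fun y hc => absurd h hc
    · filter_upwards [(hg i x hx).eventually (lt_mem_nhds h)] with y hy _
      rw [sign_pos hy, sign_pos h]
  refine (tendsto_const_nhds (x := signCorrelation (g x))).congr' ?_
  filter_upwards [hev] with y hy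
  refine (sum_mul_succ_eq (s := fun i => (SignType.sign (g x i) : ℤ))
    (t := fun i => (SignType.sign (g y i) : ℤ)) (fun i hi => ?_) fun i hi => ?_).symm
  · have : g x i ≠ 0 := fun hc => hi (by simp [hc])
    simp only [hy i this]
  · have h0 : g x i = 0 := by
      rcases lt_trichotomy (g x i) 0 with h | h | h
      · simp [sign_neg h] at hi
      · exact h
      · simp [sign_pos h] at hi
    rcases mul_neg_iff.1 (hz x hx i h0) with ⟨h1, h2⟩ | ⟨h1, h2⟩
    · simp [sign_pos h1, sign_neg h2]
    · simp [sign_neg h1, sign_pos h2]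

theorem two_mul_sub_signCorrelation {g : ZMod (2 * n) → ℝ} (hg : ∀ i, g (i + n) = -g i)
    (m : ZMod (2 * n)) : 2 * n - signCorrelation g = 2 * ∑ l ∈ Finset.range n,
      (1 - (SignType.sign (g (m + l)) : ℤ) * (SignType.sign (g (m + l + 1)) : ℤ)) := by
  rw [← sum_eq_two_mul_sum_range (fun i => (1 : ℤ) -
    (SignType.sign (g i) : ℤ) * (SignType.sign (g (i + 1)) : ℤ)), Finset.sum_sub_distrib]
  · simp [signCorrelation, ZMod.card]
  · intro i
    rw [show i + n + 1 = i + 1 + (n : ZMod (2 * n)) by ring, hg, hg, Left.sign_neg, Left.sign_neg]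
    simp

end Signs

theorem abs_sub_le_sum_Ico {s : ℕ → ℤ} (hs : ∀ l, s l = -1 ∨ s l = 0 ∨ s l = 1) {p q : ℕ}
    (hpq : p ≤ q) : |s q - s p| ≤ ∑ l ∈ Finset.Ico p q, (1 - s l * s (l + 1)) := by
  induction q, hpq using Nat.le_induction with
  | base => simp
  | succ q hpq ih =>
    rw [Finset.sum_Ico_succ_top hpq]
    have h1 : |s (q + 1) - s q| ≤ 1 - s q * s (q + 1) := by
      rcases hs q with h | h | h <;> rcases hs (q + 1) with h' | h' | h' <;> simp [h, h']
    have h2 := abs_sub_le (s (q + 1)) (s q) (s p)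
    linarith

theorem sign_cases (x : ℝ) : (SignType.sign x : ℤ) = -1 ∨ (SignType.sign x : ℤ) = 0 ∨
    (SignType.sign x : ℤ) = 1 := by
  cases SignType.sign x <;> simp

/-- A sequence with sum zero whose two ends have the same sign changes sign at least twice; if its
continuation has the opposite sign, there is a third change. -/
theorem two_lt_sum_one_sub_sign_mul_of_nonneg {m : ℕ} {r : ℕ → ℝ}
    (hsum : ∑ l ∈ Finset.range (m + 1), r l = 0)
    (h0 : 0 ≤ r 0) (hm : 0 ≤ r m) (hne : ¬(r 0 = 0 ∧ r m = 0)) (hr : r (m + 1) = -r 0) :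
    2 < ∑ l ∈ Finset.range (m + 1),
      (1 - (SignType.sign (r l) : ℤ) * (SignType.sign (r (l + 1)) : ℤ)) := by
  obtain ⟨q, hq, hq0⟩ : ∃ q < m + 1, r q < 0 := by
    by_contra! hc
    have := (Finset.sum_eq_zero_iff_of_nonneg fun l hl => hc l (Finset.mem_range.1 hl)).1 hsum
    exact hne ⟨this 0 (by simp), this m (by simp)⟩
  have hqm : q ≠ m := fun hc => by rw [hc] at hq0; linarith
  have hs := fun l => sign_cases (r l)
  have g1 := (abs_le.1 (abs_sub_le_sum_Ico hs (Nat.zero_le q))).1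
  have g2 := (abs_le.1 (abs_sub_le_sum_Ico hs (show q ≤ m by omega))).2
  have g3 := (abs_le.1 (abs_sub_le_sum_Ico hs (show m ≤ m + 1 by omega))).1
  rw [← Nat.Ico_zero_eq_range, ← Finset.sum_Ico_consecutive _ (Nat.zero_le m) (by omega),
    ← Finset.sum_Ico_consecutive _ (Nat.zero_le q) (show q ≤ m by omega)]
  have vq : (SignType.sign (r q) : ℤ) = -1 := by simp [sign_neg hq0]
  have vl : (SignType.sign (r (m + 1)) : ℤ) = -(SignType.sign (r 0) : ℤ) := by
    rw [hr, Left.sign_neg]; simp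
  have ends : 1 ≤ (SignType.sign (r 0) : ℤ) + (SignType.sign (r m) : ℤ) := by
    rcases h0.eq_or_lt with h0 | h0 <;> rcases hm.eq_or_lt with hm | hm
    · exact absurd ⟨h0.symm, hm.symm⟩ hne
    · simp [← h0, sign_pos hm]
    · simp [← hm, sign_pos h0]
    · simp [sign_pos h0, sign_pos hm]
  linarith

theorem two_lt_sum_one_sub_sign_mul {m : ℕ} {r : ℕ → ℝ}
    (hsum : ∑ l ∈ Finset.range (m + 1), r l = 0)
    (h0 : 0 ≤ r 0 * r m) (hne : ¬(r 0 = 0 ∧ r m = 0)) (hr : r (m + 1) = -r 0) :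
    2 < ∑ l ∈ Finset.range (m + 1),
      (1 - (SignType.sign (r l) : ℤ) * (SignType.sign (r (l + 1)) : ℤ)) := by
  rcases mul_nonneg_iff.1 h0 with ⟨h1, h2⟩ | ⟨h1, h2⟩
  · exact two_lt_sum_one_sub_sign_mul_of_nonneg hsum h1 h2 hne hr
  · have := two_lt_sum_one_sub_sign_mul_of_nonneg (r := fun l => -r l) (m := m) (by simp [hsum])
      (by simpa using h1) (by simpa using h2) (by simpa using hne) (by simp [hr])
    simpa [Left.sign_neg] using this

/-! ### The involute lies in the region bounded by the polygon -/

/-- The position of `x` relative to the line of the `i`-th side of `A`, when the sides of `A` are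
multiples of those of `W`. -/
noncomputable def sideForm (W A : TwoNGon n) (x : Plane) (i : ZMod (2 * n)) : ℝ :=
  det2 (x - A i) (W.side i)

theorem continuous_sideForm (W A : TwoNGon n) (i : ZMod (2 * n)) :
    Continuous fun x => sideForm W A x i :=
  continuous_det2.comp (by fun_prop : Continuous fun x : Plane => (x - A i, W.side i))

namespace IsBall

variable {W A : TwoNGon n} (h : IsBall W)
include h

theorem sideForm_half (hA : IsCentral W A) (x : Plane) (i : ZMod (2 * n)) :
    sideForm W A x (i + n) = -sideForm W A x i := by
  simp only [sideForm, hA.half, h.side_half, det2_neg_right]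

/-- A point on the line of a side but not on the side itself lies on different sides, relative to
the directions of `W`, of the lines of the two adjacent sides. -/
theorem sideForm_isolated (hA : IsCentral W A) {x : Plane} (hx : x ∉ arc A) {i : ZMod (2 * n)}
    (h0 : sideForm W A x i = 0) : sideForm W A x (i - 1) * sideForm W A x (i + 1) < 0 := by
  have p1 := h.side_pos i
  have p0 := h.side_pos (i - 1)
  rw [sub_add_cancel] at p0
  have hne : W.side i ≠ 0 := fun hc => by
    rw [hc, det2_zero_left] at p1
    exact p1.false
  obtain ⟨t, ht⟩ := exists_smul_of_det2_eq_zero (y := x - A i) hne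
    (by rw [det2_swap]; exact neg_eq_zero.2 h0)
  have s1 := hA.side_eq i
  have s0 := hA.side_eq (i - 1)
  set α := ratio W A i
  set α' := ratio W A (i - 1)
  have e1 : x - A (i + 1) = (t - α) • W.side i := by
    rw [sub_smul, ← ht, ← s1]; simp [side]
  have e0 : x - A (i - 1) = t • W.side i + α' • W.side (i - 1) := by
    rw [← ht, ← s0]; simp [side]
  have key : 0 < t * (t - α) := by
    by_contra! hc
    apply hx
    refine Set.mem_iUnion.2 ⟨i, ?_⟩
    rw [segment_eq_image']
    have hx' : x = A i + t • W.side i := by rw [← ht]; abel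
    change ∃ θ, θ ∈ Set.Icc (0 : ℝ) 1 ∧ A i + θ • A.side i = x
    rw [s1, hx']
    rcases lt_trichotomy α 0 with ha | ha | ha
    · refine ⟨t / α, ⟨?_, ?_⟩, ?_⟩
      · exact div_nonneg_of_nonpos (by nlinarith) ha.le
      · rw [div_le_one_of_neg ha]; nlinarith
      · rw [smul_smul, div_mul_cancel₀ _ ha.ne]
    · refine ⟨0, by simp, ?_⟩
      rw [ha, sub_zero] at hc
      have : t = 0 := by nlinarith [mul_self_nonneg t]
      simp [this]
    · refine ⟨t / α, ⟨?_, ?_⟩, ?_⟩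
      · exact div_nonneg (by nlinarith) ha.le
      · rw [div_le_one ha]; nlinarith
      · rw [smul_smul, div_mul_cancel₀ _ ha.ne']
  unfold sideForm
  rw [e0, e1, det2_add_left, det2_smul_left, det2_smul_left, det2_smul_left, det2_self,
    det2_swap (W.side i) (W.side (i - 1))]
  have := mul_pos key (mul_pos p0 p1)
  linarith

theorem isCentral_smul (hA : IsCentral W A) (t : ℝ) : IsCentral W fun i => t • A i :=
  h.isCentral_of_exists (fun i => by rw [hA.half]) fun i => ⟨t * ratio W A i, by
    rw [mul_smul, ← hA.side_eq]
    simp only [side, smul_sub]⟩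

/-- Summation by parts over a half turn. -/
theorem sum_sideForm (hA : IsCentral W A) (x : Plane) (j : ZMod (2 * n)) :
    ∑ l ∈ Finset.range n, sideForm W A x (j + l) =
      -2 * det2 (x - A j) (W j) - 2 * beta W A j := by
  have part : ∀ k : ℕ, ∑ l ∈ Finset.range k, sideForm W A x (j + l) =
      det2 (x - A (j + k)) (W (j + k)) - det2 (x - A j) (W j) -
        ∑ l ∈ Finset.range k, ratio W A (j + l) * det2 (W (j + l)) (W (j + l + 1)) := by
    intro k
    induction k with
    | zero => simp
    | succ k ih =>
      rw [Finset.sum_range_succ, Finset.sum_range_succ, ih,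
        show j + ((k + 1 : ℕ) : ZMod (2 * n)) = j + k + 1 by push_cast; ring]
      have e : A (j + k + 1) = A (j + k) + ratio W A (j + k) • W.side (j + k) := by
        rw [← hA.side_eq]; simp [side]
      rw [e]
      simp only [sideForm, side, det2_sub_left, det2_sub_right, det2_add_left, det2_smul_left,
        det2_self]
      ring
  rw [part n, hA.half, h.symm, det2_neg_right, beta]
  ring

variable [NeZero (2 * n)]

/-- A distant point sees exactly two sign changes: this holds for the polygon reduced to the origin
and a point in the direction of a side of `W`, and the reduction meets no arc. -/
theorem signCorrelation_of_lt_norm (hA : IsCentral W A) {R : ℝ} (hR : ∀ i, ‖A i‖ ≤ R) {y : Plane}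
    (hy : R < ‖y‖) : 2 * n - signCorrelation (sideForm W A y) = 4 := by
  have hn := h.two_le
  have hR0 : 0 ≤ R := (norm_nonneg _).trans (hR 0)
  have hy0 : y ≠ 0 := norm_pos_iff.1 (hR0.trans_lt hy)
  have hside : W.side 0 ≠ 0 := fun hc => by
    have p := h.side_pos 0
    rw [hc, det2_zero_left] at p
    exact p.false
  have harc : ∀ t ∈ Set.Icc (0 : ℝ) 1, y ∉ arc (fun i => t • A i) := by
    intro t ht hc
    have := arc_subset_of_convex (convex_closedBall (0 : Plane) R) (fun i => by
      rw [mem_closedBall_zero_iff, norm_smul, Real.norm_of_nonneg ht.1]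
      exact (mul_le_of_le_one_left (norm_nonneg _) ht.2).trans (hR i)) hc
    rw [mem_closedBall_zero_iff] at this
    linarith
  have step1 := signCorrelation_eq_of_isPreconnected (isPreconnected_Icc (a := (0 : ℝ)) (b := 1))
    (g := fun t => sideForm W (fun i => t • A i) y)
    (fun i => (continuous_det2.comp (by fun_prop :
      Continuous fun t : ℝ => (y - t • A i, W.side i))).continuousOn)
    (fun t ht i => h.sideForm_isolated (h.isCentral_smul hA t) (harc t ht))
    (x := 1) (y := 0) (by simp) (by simp)
  simp only [one_smul, zero_smul] at step1
  have h0c : IsCentral W fun _ => (0 : Plane) := by simpa using h.isCentral_smul hA 0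
  have rk : 1 < Module.rank ℝ Plane := by
    rw [← Module.finrank_eq_rank, finrank_euclideanSpace_fin]
    norm_num
  have step2 := signCorrelation_eq_of_isPreconnected
    (isConnected_compl_singleton_of_one_lt_rank rk (0 : Plane)).isPreconnected
    (g := fun z => sideForm W (fun _ => (0 : Plane)) z)
    (fun i => (continuous_sideForm W _ i).continuousOn)
    (fun z hz i => h.sideForm_isolated h0c (fun hc => hz (by
      simpa using arc_subset_of_convex (convex_singleton (0 : Plane)) (fun i => rfl) hc)))
    (x := y) (y := W.side 0) hy0 hside
  change signCorrelation (sideForm W A y) = _ at step1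
  rw [step1, step2, two_mul_sub_signCorrelation (h.sideForm_half h0c _) 0]
  obtain ⟨m, rfl⟩ : ∃ m, n = m + 2 := ⟨n - 2, by omega⟩
  have hs : ∀ l : ℕ, 0 < l → l < m + 2 → SignType.sign (sideForm W (fun _ => (0 : Plane)) (W.side 0)
      (l : ZMod (2 * (m + 2)))) = 1 := fun l h0 hl => by
    have := h.side_det_pos 0 h0 hl
    rw [zero_add] at this
    exact sign_pos (by simpa [sideForm] using this)
  have hs0 : sideForm W (fun _ => (0 : Plane)) (W.side 0) 0 = 0 := by simp [sideForm, det2_self]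
  have hsn : sideForm W (fun _ => (0 : Plane)) (W.side 0)
      ((m + 2 : ℕ) : ZMod (2 * (m + 2))) = 0 := by
    have := h.sideForm_half h0c (W.side 0) 0
    rwa [zero_add, hs0, neg_zero] at this
  have c1 : ∀ l : ℕ, (0 : ZMod (2 * (m + 2))) + l + 1 = ((l + 1 : ℕ) : ZMod (2 * (m + 2))) := by
    intro l; push_cast; ring
  simp only [c1]
  simp only [zero_add]
  rw [Finset.sum_range_succ, hsn, Finset.sum_range_succ', Finset.sum_eq_zero]
  · simp [hs0]
  · intro l hl
    have hl := Finset.mem_range.1 hl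
    rw [hs (l + 1) (by omega) (by omega), hs (l + 1 + 1) (by omega) (by omega)]
    simp

/-- A point `x` of the side of the involute that is parallel to `W j` satisfies
`∑ [x - A_i, S_i] = 0` over the half turn from `j`, and the first and the last term have the same
sign. Off `A` this gives at least three sign changes per half turn, while a point in the unbounded
component sees only one. -/
theorem arc_involute_subset (hA : IsCentral W A) : arc (involute W A) ⊆ region A := by
  intro x hx hxA
  have hxA' : ∀ R : ℝ, ∃ y : Plane, R < ‖y‖ ∧ JoinedIn (arc A)ᶜ x y := hxA
  have hxa : x ∉ arc A := fun hc => arc_subset_region A hc hxA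
  have hn := h.two_le
  obtain ⟨R, hR⟩ : ∃ R, ∀ i, ‖A i‖ ≤ R := by
    obtain ⟨m, hm⟩ := Finite.exists_max fun i => ‖A i‖
    exact ⟨_, hm⟩
  obtain ⟨y, hy, γ, hγ⟩ := hxA' R
  have far := h.signCorrelation_of_lt_norm hA hR hy
  have step := signCorrelation_eq_of_isPreconnected (isPreconnected_univ (α := unitInterval))
    (g := fun t => sideForm W A (γ t))
    (fun i => ((continuous_sideForm W A i).comp γ.continuous).continuousOn)
    (fun t _ i => h.sideForm_isolated hA (hγ t)) (x := 0) (y := 1) trivial trivial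
  simp only [γ.source, γ.target] at step
  obtain ⟨i, hi⟩ := Set.mem_iUnion.1 hx
  rw [segment_eq_image'] at hi
  obtain ⟨θ, ⟨hθ0, hθ1⟩, hθ⟩ := hi
  change involute W A i + θ • (involute W A).side i = x at hθ
  set b := beta W A (i + 1) with hb
  set v := det2 (dual W i) (dual W (i + 1)) with hv
  have hside : (involute W A).side i = -(b * v) • W (i + 1) := by
    rw [h.side_involute hA, h.dual_side, smul_neg, smul_smul, neg_smul]
  have ei : x - A i = beta W A i • dual W i - (θ * (b * v)) • W (i + 1) := by
    rw [← hθ, hside]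
    simp only [involute]
    module
  have ej : x - A (i + 1) = b • dual W (i + 1) + ((1 - θ) * (b * v)) • W (i + 1) := by
    have : involute W A i = involute W A (i + 1) - (involute W A).side i := by simp [side]
    rw [← hθ, this, hside]
    simp only [involute]
    module
  have w0 := h.pos i
  have w1 := h.pos (i + 1)
  have Gi : sideForm W A x i = -(θ * (b * v) * det2 (W i) (W (i + 1))) := by
    have : det2 (W (i + 1)) (W.side i) = det2 (W i) (W (i + 1)) := by
      simp only [side, det2_sub_right, det2_self, zero_sub]
      exact (det2_swap _ _).symm
    rw [sideForm, ei, det2_sub_left, det2_smul_left, det2_smul_left, dual_eq, det2_smul_left,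
      det2_self, this]
    ring
  have Gj : sideForm W A x (i + 1) =
      (1 - θ) * (b * v) * det2 (W (i + 1)) (W (i + 1 + 1)) := by
    rw [sideForm, ej, det2_add_left, det2_smul_left, det2_smul_left, dual_eq, det2_smul_left,
      det2_self, det2_side]
    ring
  have hsum : ∑ l ∈ Finset.range n, sideForm W A x (i + 1 + l) = 0 := by
    rw [h.sum_sideForm hA, ej, det2_add_left, det2_smul_left, det2_smul_left, det2_self,
      det2_swap, h.det_dual_self]
    ring
  have hsign := two_mul_sub_signCorrelation (h.sideForm_half hA x) (i + 1)
  have hh := h.sideForm_half hA x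
  have hiso : ¬(sideForm W A x (i + 1) = 0 ∧ sideForm W A x i = 0) := by
    rintro ⟨h1, h0⟩
    have := h.sideForm_isolated hA hxa h0
    rw [h1, mul_zero] at this
    exact this.false
  obtain ⟨m, rfl⟩ : ∃ m, n = m + 1 := ⟨n - 1, by omega⟩
  have hlast : sideForm W A x (i + 1 + (m : ℕ)) = -sideForm W A x i := by
    rw [← hh]; congr 1; push_cast; ring
  have three := two_lt_sum_one_sub_sign_mul (r := fun l : ℕ => sideForm W A x (i + 1 + l)) hsum
    (by
      simp only [Nat.cast_zero, add_zero, hlast, Gi, Gj]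
      have h1 : 0 ≤ 1 - θ := by linarith
      have : (1 - θ) * (b * v) * det2 (W (i + 1)) (W (i + 1 + 1)) *
          - -(θ * (b * v) * det2 (W i) (W (i + 1))) =
          (1 - θ) * θ * (b * v) ^ 2 *
            (det2 (W (i + 1)) (W (i + 1 + 1)) * det2 (W i) (W (i + 1))) := by ring
      rw [this]
      positivity)
    (by simpa [hlast] using hiso)
    (by simp only [hh, Nat.cast_zero, add_zero])
  have c1 : ∀ l : ℕ, i + 1 + ((l + 1 : ℕ) : ZMod (2 * (m + 1))) = i + 1 + l + 1 := by
    intro l; push_cast; ring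
  simp only [c1] at three
  rw [step] at hsign
  omega

end IsBall

/-! ### Convergence of the iterated involutes -/

theorem continuous_ratio (W : TwoNGon n) (i : ZMod (2 * n)) :
    Continuous fun A : TwoNGon n => ratio W A i := by
  unfold ratio
  exact (continuous_det2.comp (by fun_prop :
    Continuous fun A : TwoNGon n => (W i, A (i + 1) - A i))).div_const _

theorem continuous_involute (W : TwoNGon n) : Continuous fun A : TwoNGon n => involute W A := by
  refine continuous_pi fun i => ?_
  unfold involute beta
  have := continuous_ratio W
  fun_prop

theorem continuous_doubleInvolute (W : TwoNGon n) :
    Continuous fun A : TwoNGon n => doubleInvolute W A :=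
  continuous_pi fun i => (continuous_apply (i - 1)).comp
    ((continuous_involute (dual W)).comp (continuous_involute W))

theorem isCentral_of_tendsto {W B : TwoNGon n} {A : ℕ → TwoNGon n}
    (hA : ∀ k, IsCentral W (A k)) (hB : Tendsto A atTop (𝓝 B)) : IsCentral W B where
  half i := tendsto_nhds_unique ((hB.apply_nhds (i + n)).congr fun k => (hA k).half i)
    (hB.apply_nhds i)
  side_eq i := by
    have h1 : Tendsto (fun k => (A k).side i) atTop (𝓝 (B.side i)) :=
      (hB.apply_nhds (i + 1)).sub (hB.apply_nhds i)
    have h2 := (((continuous_ratio W i).tendsto B).comp hB).smul_const (W.side i)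
    exact tendsto_nhds_unique (h1.congr fun k => (hA k).side_eq i) h2

theorem IsBall.eq_of_ratio_eq_zero {W A : TwoNGon n} (h : IsBall W) (hA : IsCentral W A)
    (h0 : ∀ i, ratio W A i = 0) (i : ZMod (2 * n)) : A i = A 0 := by
  obtain ⟨k, -, rfl⟩ := h.exists_eq_add 0 i
  clear * - hA h0
  induction k with
  | zero => simp
  | succ k ih =>
    rw [← ih]
    have := hA.side_eq (0 + k)
    rw [h0, zero_smul] at this
    rw [← sub_eq_zero.1 this]
    congr 1; push_cast; ring

section Limit

variable [NeZero (2 * n)]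

theorem continuous_energy (W : TwoNGon n) : Continuous fun A : TwoNGon n => energy W A := by
  unfold energy
  have := continuous_ratio W
  fun_prop

/-- A limit point of a bounded sequence of double involutes has the same energy as its own double
involute, so all its vertices coincide. -/
theorem IsBall.exists_subseq_tendsto_const {W : TwoNGon n} (h : IsBall W) {M : ℕ → TwoNGon n}
    (hM : ∀ k, IsCentral W (M k)) (hs : ∀ k, M (k + 1) = doubleInvolute W (M k)) {R : ℝ}
    (hR : ∀ k i, M k i ∈ Metric.closedBall (0 : Plane) R) :
    ∃ (O : Plane) (φ : ℕ → ℕ), StrictMono φ ∧ ∀ i, Tendsto (fun j => M (φ j) i) atTop (𝓝 O) := by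
  obtain ⟨B, -, φ, hφ, hB⟩ := (isCompact_univ_pi fun _ : ZMod (2 * n) =>
    isCompact_closedBall (0 : Plane) R).tendsto_subseq fun k => (fun i _ => hR k i :
      M k ∈ Set.pi Set.univ fun _ => Metric.closedBall (0 : Plane) R)
  have anti : Antitone fun k => energy W (M k) := antitone_nat_of_succ_le fun k => by
    rw [hs]; exact (h.energy_doubleInvolute (hM k)).1
  have lim := tendsto_atTop_ciInf anti ⟨0, by rintro _ ⟨k, rfl⟩; exact h.energy_nonneg _⟩
  have l1 := ((continuous_energy W).tendsto B).comp hB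
  have l2 := (((continuous_energy W).comp (continuous_doubleInvolute W)).tendsto B).comp hB
  have e1 := tendsto_nhds_unique l1 (lim.comp hφ.tendsto_atTop)
  have e2 := tendsto_nhds_unique l2 (((tendsto_add_atTop_iff_nat 1).2 lim).comp
    hφ.tendsto_atTop |>.congr fun j => by simp [hs])
  have hBc := isCentral_of_tendsto (fun j => hM (φ j)) hB
  have hr := (h.energy_doubleInvolute hBc).2 (e2.trans e1.symm)
  refine ⟨B 0, φ, hφ, fun i => ?_⟩
  have := hB.apply_nhds i
  rwa [h.eq_of_ratio_eq_zero hBc hr i] at this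

namespace IsConvexWithParallelSides

variable {P : TwoNGon n} (hP : P.IsConvexWithParallelSides) {a : ℝ} (ha : 0 < a)
include hP ha

theorem region_iterN_subset (k : ℕ) : region (iterN a P (k + 1)) ⊆ region (iterM a P k) :=
  region_subset_of_arc_subset
    ((hP.isBall_ball ha).arc_involute_subset (hP.isCentral_iterM ha k))

theorem region_iterM_succ_subset (k : ℕ) :
    region (iterM a P (k + 1)) ⊆ region (iterN a P (k + 1)) := by
  refine region_subset_of_arc_subset ?_
  rw [iterM_succ]
  unfold doubleInvolute
  rw [arc_pred]
  exact (hP.isBall_ball ha).isBall_dual.arc_involute_subset (hP.isCentral_iterN ha (k + 1))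

theorem antitone_region_iterM : Antitone fun k => region (iterM a P k) :=
  antitone_nat_of_succ_le fun k =>
    (hP.region_iterM_succ_subset ha k).trans (hP.region_iterN_subset ha k)

/-- The nested regions shrink to a point, to which all the iterated involutes converge. -/
theorem exists_limit : ∃ O : Plane, centralSet a P = {O} ∧
    (∀ i, Tendsto (fun k => iterM a P k i) atTop (𝓝 O)) ∧
    ∀ i, Tendsto (fun k => iterN a P k i) atTop (𝓝 O) := by
  have memM : ∀ {k l}, k ≤ l → ∀ i, iterM a P l i ∈ region (iterM a P k) := fun hkl i =>
    hP.antitone_region_iterM ha hkl (arc_subset_region _ (mem_arc _ i))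
  obtain ⟨R, hR⟩ : ∃ R, ∀ i, ‖iterM a P 0 i‖ ≤ R := by
    obtain ⟨m, hm⟩ := Finite.exists_max fun i => ‖iterM a P 0 i‖
    exact ⟨_, hm⟩
  obtain ⟨O, φ, hφ, hO⟩ := (hP.isBall_ball ha).exists_subseq_tendsto_const
    (hP.isCentral_iterM ha) (fun k => iterM_succ a P k) (R := R) fun k i =>
      region_subset_closedBall (fun j => by simpa using hR j) (memM (Nat.zero_le k) i)
  -- some region, hence every later one, is as small as desired
  have small : ∀ ε > 0, ∃ k, region (iterM a P k) ⊆ Metric.closedBall O ε := by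
    intro ε hε
    obtain ⟨j, hj⟩ := (eventually_all.2 fun i =>
      (hO i).eventually (Metric.closedBall_mem_nhds O hε)).exists
    exact ⟨φ j, region_subset_closedBall hj⟩
  have hOM : ∀ k, O ∈ region (iterM a P k) := fun k =>
    (isClosed_region _).mem_of_tendsto (hO 0) ((eventually_ge_atTop k).mono fun j hj =>
      memM (hj.trans (hφ.id_le j)) 0)
  refine ⟨O, ?_, fun i => ?_, fun i => ?_⟩
  · ext x
    simp only [centralSet, Set.mem_iInter, Set.mem_inter_iff, Set.mem_singleton_iff]
    constructor
    · intro hx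
      refine eq_of_forall_dist_le fun ε hε => ?_
      obtain ⟨k, hk⟩ := small ε hε
      exact hk (hx k).1
    · rintro rfl k
      exact ⟨hOM k, hP.region_iterM_succ_subset ha k (hOM (k + 1))⟩
  · refine Metric.nhds_basis_closedBall.tendsto_right_iff.2 fun ε hε => ?_
    obtain ⟨k, hk⟩ := small ε hε
    exact (eventually_ge_atTop k).mono fun l hl => hk (memM hl i)
  · refine Metric.nhds_basis_closedBall.tendsto_right_iff.2 fun ε hε => ?_
    obtain ⟨k, hk⟩ := small ε hε
    refine (eventually_ge_atTop (k + 1)).mono fun l hl => hk ?_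
    obtain ⟨l, rfl⟩ := Nat.exists_eq_add_of_le' (show 1 ≤ l by omega)
    exact hP.antitone_region_iterM ha (show k ≤ l by omega)
      (hP.region_iterN_subset ha l (arc_subset_region _ (mem_arc _ i)))

end IsConvexWithParallelSides

end Limit

end TwoNGon

theorem mainTheorem2 (n : ℕ) (P : TwoNGon n) (hP : P.IsConvexWithParallelSides)
    (a : ℝ) (ha : 0 < a) :
    ∃ O : Plane, TwoNGon.centralSet a P = {O} ∧ ∀ c d : ℝ,
      (∀ k : ℕ, TwoNGon.HasConstantWidth (TwoNGon.ball a P)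
        (TwoNGon.equidistant (TwoNGon.ball a P) (TwoNGon.iterM a P k) c) (2 * c)) ∧
      (∀ k : ℕ, TwoNGon.HasConstantWidth (TwoNGon.ball a P).dual
        (TwoNGon.equidistant (TwoNGon.ball a P).dual (TwoNGon.iterN a P k) d) (2 * d)) ∧
      Filter.Tendsto
        (fun k : ℕ => TwoNGon.equidistant (TwoNGon.ball a P) (TwoNGon.iterM a P k) c)
        Filter.atTop (nhds (fun i => O + c • TwoNGon.ball a P i)) ∧
      Filter.Tendsto
        (fun k : ℕ => TwoNGon.equidistant (TwoNGon.ball a P).dual (TwoNGon.iterN a P k) d)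
        Filter.atTop (nhds (fun i => O + d • (TwoNGon.ball a P).dual i)) := by
  have hn := hP.two_le
  have : NeZero (2 * n) := ⟨by omega⟩
  have h := hP.isBall_ball ha
  obtain ⟨O, hO, hM, hN⟩ := hP.exists_limit ha
  exact ⟨O, hO, fun c d => ⟨fun k => h.hasConstantWidth (hP.isCentral_iterM ha k) c,
    fun k => h.isBall_dual.hasConstantWidth (hP.isCentral_iterN ha k) d,
    tendsto_pi_nhds.2 fun i => (hM i).add_const _,
    tendsto_pi_nhds.2 fun i => (hN i).add_const _⟩⟩
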